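/- Let $\mathfrak g=\mathfrak g_{-1}\oplus\mathfrak g_0\oplus\mathfrak g_1$ be a type I quasi-reductive Lie superalgebra over $\mathbb C$: $\mathfrak g$ is finite-dimensional, its even part $\mathfrak g_0$ is a reductive Lie algebra, its odd part $\mathfrak g_{-1}\oplus\mathfrak g_1$ is a semisimple $\mathfrak g_0$-module, $\mathfrak g_{\pm1}$ are $\mathfrak g_0$-submodules, and $[\mathfrak g_1,\mathfrak g_1]=[\mathfrak g_{-1},\mathfrak g_{-1}]=0$. Let $\mathfrak h'$ be the centre of $\mathfrak g_0$, so that $\mathfrak g_0=\mathfrak h'\oplus[\mathfrak g_0,\mathfrak g_0]$. For $\nu\in(\mathfrak h')^*$ and $n\ge 0$ let $J_n(\nu)$ be the $\mathfrak g_0$-module with basis $v_1,\dots,v_n$ on which $[\mathfrak g_0,\mathfrak g_0]$ acts by zero and $hv_i=\nu(h)v_{i+1}$ for $i<n$, $hv_n=0$, for $h\in\mathfrak h'$. For a $\mathfrak g_0$-module $M$ (placed in even degree, with $\mathfrak g_1$ acting by zero) let $K(M)=\mathrm{Ind}_{\mathfrak g_0+\mathfrak g_1}^{\mathfrak g}M$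 be its Kac module, and put $K(L;n;\nu)=K(L\otimes J_n(\nu))$. Let $L$ be a $\mathfrak g_0$-module. (1) For all $n$ and $\nu$, the module $K(L;n;\nu)$ has a filtration $0=F_0\subseteq F_1\subseteq\dots\subseteq F_n=K(L;n;\nu)$ by graded $\mathfrak g$-submodules with all factors $F_{i+1}/F_i$ isomorphic to $K(L)$ as supermodules. (2) Let $L$ be indecomposable and $n\ge1$. If $n=1$, or if some $z\in\mathfrak h'$ with $\nu(z)\neq0$ acts on $L$ by a scalar (so in particular if $\nu\ne0$ and $\mathfrak h'$ acts on $L$ by scalars, as it does on every highest weight module), then $K(L;n;\nu)$ is an indecomposable $\mathfrak g$-module (even with respect to decompositions into submodules that need not be graded). (3) Let $\mathfrak h$ be a Cartan subalgebra of $\mathfrak g_0$, $\mathfrak b\supseteq\mathfrak h$ a Borel subalgebra of $\mathfrak g_0$, and $L$ a finite-dimensional $\mathfrak g_0$-module of highest weight $\lambda\in\mathfrak h^*$ with highest weight vector $v$. Then $K(L)$ is finite-dimensional and is a highest weight module for $\mathfrak b+\mathfrak g_1$ with highest weight $\lambda$ and highest weight vector $v_\lambda=1\otimes v$. For a self-extension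 $0\to K(L)\xrightarrow{\phi_1}N\xrightarrow{\phi_2}K(L)\to0$ of supermodules (with even maps) call $\mu\in\mathfrak h^*$ its value under $\Upsilon_{K(L)}$ if for some $v'$ in the generalized weight space $N_\lambda$ with $\phi_2(v')=v_\lambda$ one has $hv'=\lambda(h)v'+\mu(h)\phi_1(v_\lambda)$ for all $h\in\mathfrak h$. If the generalized weight space $K(L)_\lambda$ is spanned by $v_\lambda$, then every self-extension has exactly one value, so that $\Upsilon_{K(L)}:\mathrm{Ext}^1_{\mathfrak g}(K(L),K(L))\to\mathfrak h^*$ is a well-defined map. In general let $\Upsilon_{K(L)}$ send a class that has a value to a value, and a class without one to $0$. Identify $(\mathfrak h')^*$ with $\{\mu\in\mathfrak h^*:\mu|_{\mathfrak h\cap[\mathfrak g_0,\mathfrak g_0]}=0\}$ (extend by zero on $\mathfrak h\cap[\mathfrak g_0,\mathfrak g_0]$). Then for every $\nu\in(\mathfrak h')^*$ the module $K(L;2;\nu)$ is the middle term of a self-extension of $K(L)$ that has the value $\nu$ and is sent to $\nu$ by $\Upsilon_{K(L)}$, and the image of $\Upsilon_{K(L)}$ is exactly $(\mathfrak h')^*$.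 -/

import Mathlib

open scoped TensorProduct

noncomputable section

universe u v w

namespace SuperLie

/-! ### Lie superalgebras over the complex numbers -/

/-- The Koszul sign `(-1)^(|x||y|)`. -/
def sgn (i j : ZMod 2) : ℂ := (-1) ^ (i.val * j.val)

/-- A complex Lie superalgebra: a `ℤ/2`-graded vector space `g = part 0 ⊕ part 1` with an even
super-skew-symmetric bracket satisfying the super Jacobi identity. -/
class LieSuperalgebra (g : Type u) [AddCommGroup g] [Module ℂ g] where
  part : ZMod 2 → Submodule ℂ g
  isCompl : IsCompl (part 0) (part 1)
  br : g →ₗ[ℂ] g →ₗ[ℂ] g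
  br_mem : ∀ i j x y, x ∈ part i → y ∈ part j → br x y ∈ part (i + j)
  skew : ∀ i j x y, x ∈ part i → y ∈ part j → br x y = -(sgn i j • br y x)
  jacobi : ∀ i j x y z, x ∈ part i → y ∈ part j →
    br x (br y z) = br (br x y) z + sgn i j • br y (br x z)

section basic

variable (g : Type u) [AddCommGroup g] [Module ℂ g] [LieSuperalgebra g]

/-- The even part `g_0` of a Lie superalgebra. -/
abbrev EvenPart : Type u := ↥(LieSuperalgebra.part (g := g) 0)

variable {g}

open LieSuperalgebra

theorem zmod_two (i : ZMod 2) : i = 0 ∨ i = 1 := by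
  fin_cases i
  · exact Or.inl rfl
  · exact Or.inr rfl

theorem sgn_zero_left (j : ZMod 2) : sgn 0 j = 1 := by simp [sgn]

theorem sgn_zero_right (j : ZMod 2) : sgn j 0 = 1 := by simp [sgn]

instance : Bracket (EvenPart g) (EvenPart g) :=
  ⟨fun x y => ⟨br x.1 y.1, by simpa using br_mem 0 0 x.1 y.1 x.2 y.2⟩⟩

theorem coe_bracket (x y : EvenPart g) : ((⁅x, y⁆ : EvenPart g) : g) = br x.1 y.1 := rfl

/-- The even part of a Lie superalgebra is a Lie algebra. -/
instance : LieRing (EvenPart g) where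
  add_lie x y z := Subtype.ext (by simp [coe_bracket])
  lie_add x y z := Subtype.ext (by simp [coe_bracket])
  lie_self x := Subtype.ext (by
    have h := skew (g := g) 0 0 x.1 x.1 x.2 x.2
    rw [sgn_zero_left, one_smul] at h
    have h2 : (2 : ℂ) • br x.1 x.1 = 0 := by rw [two_smul]; exact add_eq_zero_iff_eq_neg.mpr h
    exact (smul_eq_zero.mp h2).resolve_left two_ne_zero)
  leibniz_lie x y z := Subtype.ext (by
    have h := jacobi (g := g) 0 0 x.1 y.1 z.1 x.2 y.2
    rw [sgn_zero_left, one_smul] at h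
    simpa [coe_bracket] using h)

instance : LieAlgebra ℂ (EvenPart g) where
  lie_smul c x y := Subtype.ext (by simp [coe_bracket])

end basic

/-- A Lie algebra is reductive if its adjoint representation is semisimple, i.e. every ideal has
a complementary ideal. (For finite-dimensional complex Lie algebras this is equivalent to the
radical being the centre, and to being the product of a semisimple and an abelian algebra.) -/
class IsReductive (k : Type u) [LieRing k] [LieAlgebra ℂ k] : Prop where
  complemented : ComplementedLattice (LieIdeal ℂ k)

/-- A finite-dimensional Lie superalgebra is quasi-reductive if its even part is a reductive Lie
algebra and its odd part is a semisimple module over the even part. -/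
class IsQuasiReductive (g : Type u) [AddCommGroup g] [Module ℂ g] [LieSuperalgebra g] :
    Prop where
  finite : FiniteDimensional ℂ g
  reductive : IsReductive (EvenPart g)
  semisimple_odd : ∀ W : Submodule ℂ g, W ≤ LieSuperalgebra.part 1 →
    (∀ (a : EvenPart g), ∀ x ∈ W, LieSuperalgebra.br a.1 x ∈ W) →
    ∃ W' : Submodule ℂ g, W' ≤ LieSuperalgebra.part 1 ∧
      (∀ (a : EvenPart g), ∀ x ∈ W', LieSuperalgebra.br a.1 x ∈ W') ∧
      W ⊓ W' = ⊥ ∧ W ⊔ W' = LieSuperalgebra.part 1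

instance {g : Type u} [AddCommGroup g] [Module ℂ g] [LieSuperalgebra g] [h : IsQuasiReductive g] :
    IsReductive (EvenPart g) := h.reductive

/-- A type I structure on `g`: a `ℤ`-grading `g = g_{-1} ⊕ g_0 ⊕ g_1` with `g_0` the even part and
`g_{-1} ⊕ g_1` the odd part (so `[g_1, g_1] = [g_{-1}, g_{-1}] = 0`; that `[g_{-1}, g_1] ⊆ g_0` is
automatic). -/
structure TypeI (g : Type u) [AddCommGroup g] [Module ℂ g] [LieSuperalgebra g] where
  neg : Submodule ℂ g
  pos : Submodule ℂ g
  disjoint : neg ⊓ pos = ⊥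
  sup_eq : neg ⊔ pos = LieSuperalgebra.part 1
  even_neg : ∀ a : EvenPart g, ∀ x ∈ neg, LieSuperalgebra.br a.1 x ∈ neg
  even_pos : ∀ a : EvenPart g, ∀ x ∈ pos, LieSuperalgebra.br a.1 x ∈ pos
  neg_neg : ∀ x ∈ neg, ∀ y ∈ neg, LieSuperalgebra.br x y = 0
  pos_pos : ∀ x ∈ pos, ∀ y ∈ pos, LieSuperalgebra.br x y = 0

/-! ### The enveloping superalgebra and supermodules -/

section enveloping

variable (g : Type u) [AddCommGroup g] [Module ℂ g] [LieSuperalgebra g]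

open LieSuperalgebra

/-- The relations `x y - (-1)^(|x||y|) y x = [x, y]`, for homogeneous `x, y`, defining `U(g)`. -/
inductive URel : TensorAlgebra ℂ g → TensorAlgebra ℂ g → Prop
  | rel (i j : ZMod 2) (x y : g) (hx : x ∈ part i) (hy : y ∈ part j) :
      URel (TensorAlgebra.ι ℂ x * TensorAlgebra.ι ℂ y)
        (sgn i j • (TensorAlgebra.ι ℂ y * TensorAlgebra.ι ℂ x) + TensorAlgebra.ι ℂ (br x y))

/-- The universal enveloping superalgebra `U(g)`. A `g`-module is a module over `U(g)`. -/
def U : Type u := RingQuot (URel g)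

instance : Ring (U g) := inferInstanceAs (Ring (RingQuot (URel g)))

instance : Algebra ℂ (U g) := inferInstanceAs (Algebra ℂ (RingQuot (URel g)))

variable {g}

/-- The canonical map `g → U(g)`. -/
def ι : g →ₗ[ℂ] U g :=
  (RingQuot.mkAlgHom ℂ (URel g)).toLinearMap ∘ₗ TensorAlgebra.ι ℂ

theorem ι_mul (i j : ZMod 2) (x y : g) (hx : x ∈ part i) (hy : y ∈ part j) :
    ι x * ι y = sgn i j • (ι y * ι x) + ι (br x y) := by
  have h := RingQuot.mkAlgHom_rel ℂ (URel.rel i j x y hx hy)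
  simp only [map_mul, map_add, map_smul] at h
  exact h

/-- An algebra map out of `U(g)` from a linear map that respects the super bracket. -/
def liftU {A : Type w} [Ring A] [Algebra ℂ A] (f : g →ₗ[ℂ] A)
    (hf : ∀ i j x y, x ∈ part i → y ∈ part j →
      f x * f y = sgn i j • (f y * f x) + f (br x y)) : U g →ₐ[ℂ] A :=
  RingQuot.liftAlgHom ℂ ⟨TensorAlgebra.lift ℂ f, by
    rintro _ _ ⟨i, j, x, y, hx, hy⟩
    simpa using hf i j x y hx hy⟩

theorem liftU_ι {A : Type w} [Ring A] [Algebra ℂ A] (f : g →ₗ[ℂ] A)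
    (hf : ∀ i j x y, x ∈ part i → y ∈ part j →
      f x * f y = sgn i j • (f y * f x) + f (br x y)) (x : g) : liftU f hf (ι x) = f x := by
  unfold liftU ι
  exact (RingQuot.liftAlgHom_mkAlgHom_apply ℂ _ _ _).trans (TensorAlgebra.lift_ι_apply f x)

theorem U_hom_ext {A : Type w} [Ring A] [Algebra ℂ A] {f f' : U g →ₐ[ℂ] A}
    (h : ∀ x, f (ι x) = f' (ι x)) : f = f' :=
  RingQuot.ringQuot_ext' ℂ _ _ (TensorAlgebra.hom_ext (LinearMap.ext h))

/-- The parity operator `x ↦ x_even - x_odd` of `g`. -/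
def par : g →ₗ[ℂ] g :=
  (part (g := g) 0).projection (part 1) isCompl - (part (g := g) 1).projection (part 0) isCompl.symm

theorem par_of_mem (i : ZMod 2) (x : g) (hx : x ∈ part i) : par x = (-1 : ℂ) ^ i.val • x := by
  rcases zmod_two i with rfl | rfl
  · simp [par, Submodule.projection_apply, Submodule.projectionOnto_apply_of_mem_left _ hx,
      Submodule.projectionOnto_apply_of_mem_right _ hx]
  · simp [par, Submodule.projection_apply, Submodule.projectionOnto_apply_of_mem_left _ hx,
      Submodule.projectionOnto_apply_of_mem_right _ hx, ZMod.val_one]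

theorem par_par (x : g) : par (par x) = x := by
  obtain ⟨a, ha, b, hb, rfl⟩ := Submodule.mem_sup.mp
    (show x ∈ part (g := g) 0 ⊔ part 1 by rw [isCompl.sup_eq_top]; trivial)
  rw [map_add, par_of_mem 0 a ha, par_of_mem 1 b hb, map_add, map_smul, map_smul,
    par_of_mem 0 a ha, par_of_mem 1 b hb, smul_smul, smul_smul]
  simp [ZMod.val_one]

/-- The parity automorphism of `U(g)`: the identity on `U(g)_0`, minus the identity on `U(g)_1`. -/
def parU : U g →ₐ[ℂ] U g :=
  liftU (ι ∘ₗ par) (by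
    intro i j x y hx hy
    have hij : (-1 : ℂ) ^ (i + j).val = (-1) ^ i.val * (-1) ^ j.val := by
      have h11 : (1 + 1 : ZMod 2) = 0 := rfl
      rcases zmod_two i with rfl | rfl <;> rcases zmod_two j with rfl | rfl <;>
        simp [ZMod.val_one, h11]
    simp only [LinearMap.comp_apply, par_of_mem i x hx, par_of_mem j y hy,
      par_of_mem _ _ (br_mem i j x y hx hy), map_smul, smul_mul_smul_comm]
    rw [ι_mul i j x y hx hy, hij, mul_comm ((-1 : ℂ) ^ j.val), smul_add, smul_comm])

theorem parU_ι (x : g) : parU (ι x) = ι (par x) := liftU_ι _ _ x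

theorem parU_parU (a : U g) : parU (parU a) = a := by
  have h : (parU (g := g)).comp parU = AlgHom.id ℂ (U g) :=
    U_hom_ext fun x => by simp [parU_ι, par_par]
  exact DFunLike.congr_fun h a

/-- The parity automorphism as a ring homomorphism. -/
abbrev parR : U g →+* U g := (parU (g := g)).toRingHom

end enveloping

/-- A `g`-supermodule: a `U(g)`-module `N` with a `ℤ/2`-grading compatible with that of `U(g)`.
The grading `N = N_0 ⊕ N_1` is recorded by its parity operator, which is `1` on `N_0` and `-1`
on `N_1`; compatibility with the action reads `P (a • n) = P(a) • P(n)`. -/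
class SuperModule (g : Type u) [AddCommGroup g] [Module ℂ g] [LieSuperalgebra g]
    (N : Type w) [AddCommGroup N] [Module (U g) N] where
  parity : N →ₛₗ[parR (g := g)] N
  parity_parity : ∀ n, parity (parity n) = n

/-- A `U(g)`-linear map of supermodules is even if it preserves the grading. -/
def IsEvenMap {g : Type u} [AddCommGroup g] [Module ℂ g] [LieSuperalgebra g]
    {N : Type v} [AddCommGroup N] [Module (U g) N] [SuperModule g N]
    {N' : Type w} [AddCommGroup N'] [Module (U g) N'] [SuperModule g N']
    (f : N →ₗ[U g] N') : Prop :=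
  ∀ n, f (SuperModule.parity (g := g) n) = SuperModule.parity (g := g) (f n)

/-- A module is indecomposable if it is nonzero and is not the direct sum of two proper
submodules. (For supermodules all submodules are allowed here, graded or not.) -/
def IsIndecomposable (A : Type u) [Ring A] (N : Type w) [AddCommGroup N] [Module A N] : Prop :=
  Nontrivial N ∧ ∀ S T : Submodule A N, IsCompl S T → S = ⊥ ∨ T = ⊥

/-- Indecomposability for modules over a Lie algebra. -/
def IsLieIndecomposable (k : Type u) [LieRing k] [LieAlgebra ℂ k]
    (L : Type v) [AddCommGroup L] [Module ℂ L] [LieRingModule k L] [LieModule ℂ k L] : Prop :=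
  Nontrivial L ∧ ∀ S T : LieSubmodule ℂ k L, IsCompl S T → S = ⊥ ∨ T = ⊥

/-- The supermodule `N` has a filtration `0 = F_0 ⊆ F_1 ⊆ ⋯ ⊆ F_n = N` by graded submodules such
that each `F_{i+1}/F_i` is isomorphic to `K` as a supermodule. -/
def HasFiltration (g : Type u) [AddCommGroup g] [Module ℂ g] [LieSuperalgebra g] (n : ℕ)
    (N : Type v) [AddCommGroup N] [Module (U g) N] [SuperModule g N]
    (K : Type w) [AddCommGroup K] [Module (U g) K] [SuperModule g K] : Prop :=
  ∃ F : Fin (n + 1) → Submodule (U g) N,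
    Monotone F ∧ F 0 = ⊥ ∧ F (Fin.last n) = ⊤ ∧
    (∀ i, ∀ x ∈ F i, SuperModule.parity (g := g) x ∈ F i) ∧
    ∀ i : Fin n, ∃ e : (↥(F i.succ) ⧸ (F i.castSucc).submoduleOf (F i.succ)) ≃ₗ[U g] K,
      ∀ x y : ↥(F i.succ), (y : N) = SuperModule.parity (g := g) (x : N) →
        e (Submodule.Quotient.mk y) = SuperModule.parity (g := g) (e (Submodule.Quotient.mk x))

/-! ### Kac modules -/

section kac

variable {g : Type u} [AddCommGroup g] [Module ℂ g] [LieSuperalgebra g] (T : TypeI g)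
variable (M : Type v) [AddCommGroup M] [Module ℂ M] [LieRingModule (EvenPart g) M]
  [LieModule ℂ (EvenPart g) M]

/-- The relations `a ⊗ m = 1 ⊗ a m` for `a ∈ g_0` and `b ⊗ m = 0` for `b ∈ g_1`, which present
`U(g) ⊗_{U(g_0 + g_1)} M` (with `g_1` acting on `M` by zero) as a quotient of `U(g) ⊗_ℂ M`. -/
def kacRel : Submodule (U g) (U g ⊗[ℂ] M) :=
  Submodule.span (U g)
    ({t | ∃ (a : EvenPart g) (m : M), t = ι a.1 ⊗ₜ[ℂ] m - 1 ⊗ₜ[ℂ] ⁅a, m⁆} ∪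
     {t | ∃ b ∈ T.pos, ∃ m : M, t = ι b ⊗ₜ[ℂ] m})

/-- The Kac module `K(M) = Ind_{g_0 + g_1}^g M` of a `g_0`-module `M`, on which `g_1` acts by
zero. -/
def Kac : Type (max u v) := (U g ⊗[ℂ] M) ⧸ kacRel T M

instance : AddCommGroup (Kac T M) := inferInstanceAs (AddCommGroup ((U g ⊗[ℂ] M) ⧸ kacRel T M))

instance : Module (U g) (Kac T M) := inferInstanceAs (Module (U g) ((U g ⊗[ℂ] M) ⧸ kacRel T M))

instance : Module ℂ (Kac T M) := inferInstanceAs (Module ℂ ((U g ⊗[ℂ] M) ⧸ kacRel T M))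

instance : IsScalarTower ℂ (U g) (Kac T M) :=
  inferInstanceAs (IsScalarTower ℂ (U g) ((U g ⊗[ℂ] M) ⧸ kacRel T M))

/-- The canonical map `M → K(M)`, `m ↦ 1 ⊗ m`. -/
def Kac.mk : M →ₗ[ℂ] Kac T M :=
  ((kacRel T M).mkQ.restrictScalars ℂ) ∘ₗ (TensorProduct.mk ℂ (U g) M 1)

/-- The parity operator of `U(g) ⊗ M`, with `M` purely even. -/
def tensorParity : (U g ⊗[ℂ] M) →ₛₗ[parR (g := g)] (U g ⊗[ℂ] M) where
  toFun := TensorProduct.map (parU (g := g)).toLinearMap LinearMap.id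
  map_add' := map_add _
  map_smul' a t := by
    induction t with
    | zero => simp
    | add x y hx hy => simp only [smul_add, map_add, hx, hy]
    | tmul b m => simp [TensorProduct.smul_tmul']

theorem tensorParity_tmul (a : U g) (m : M) :
    tensorParity M (a ⊗ₜ[ℂ] m) = parU a ⊗ₜ[ℂ] m := rfl

theorem kacRel_le : kacRel T M ≤ (kacRel T M).comap (tensorParity M) := by
  refine Submodule.span_le.mpr ?_
  rintro t (⟨a, m, rfl⟩ | ⟨b, hb, m, rfl⟩)
  · refine Submodule.mem_comap.mpr ?_
    rw [map_sub, tensorParity_tmul, tensorParity_tmul, map_one, parU_ι, par_of_mem 0 a.1 a.2]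
    refine Submodule.subset_span (Or.inl ⟨a, m, ?_⟩)
    simp
  · refine Submodule.mem_comap.mpr ?_
    have hb1 : b ∈ LieSuperalgebra.part (g := g) 1 := T.sup_eq ▸ Submodule.mem_sup_right hb
    rw [tensorParity_tmul, parU_ι, par_of_mem 1 b hb1]
    exact Submodule.subset_span (Or.inr ⟨_, T.pos.smul_mem _ hb, m, rfl⟩)

/-- The grading of the Kac module induced from that of `U(g)`, with `M` purely even. -/
instance : SuperModule g (Kac T M) where
  parity := (kacRel T M).mapQ (kacRel T M) (tensorParity M) (kacRel_le T M)
  parity_parity n := by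
    obtain ⟨t, rfl⟩ := (kacRel T M).mkQ_surjective n
    change Submodule.Quotient.mk (tensorParity M (tensorParity M t)) = Submodule.Quotient.mk t
    congr 1
    induction t with
    | zero => exact (congrArg _ (map_zero (tensorParity M))).trans (map_zero (tensorParity M))
    | add x y hx hy => rw [map_add, map_add, hx, hy]
    | tmul b m => rw [tensorParity_tmul, tensorParity_tmul, parU_parU]

end kac

/-! ### Jordan-type modules -/

section jordan

variable {k : Type u} [LieRing k] [LieAlgebra ℂ k]

open LieAlgebra

variable (k) in
/-- A reductive Lie algebra `k` is the direct sum of its centre and `[k, k]`. -/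
theorem isCompl_center [hk : IsReductive k] :
    IsCompl (center ℂ k).toSubmodule (⁅(⊤ : LieIdeal ℂ k), (⊤ : LieIdeal ℂ k)⁆).toSubmodule := by
  have := hk.complemented
  set D : LieIdeal ℂ k := ⁅(⊤ : LieIdeal ℂ k), (⊤ : LieIdeal ℂ k)⁆ with hD
  obtain ⟨I, hI⟩ := exists_isCompl (center ℂ k)
  obtain ⟨E, hE⟩ := exists_isCompl D
  have hDI : D ≤ I := by
    rw [hD, LieSubmodule.lieIdeal_oper_eq_span, LieSubmodule.lieSpan_le]
    rintro _ ⟨⟨x, -⟩, ⟨y, -⟩, rfl⟩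
    obtain ⟨a, ha, b, hb, rfl⟩ := (LieSubmodule.mem_sup _ _ _).mp
      (show y ∈ center ℂ k ⊔ I by rw [hI.sup_eq_top]; trivial)
    have : ⁅x, a⁆ = 0 := ha x
    simp only [lie_add, this, zero_add, SetLike.mem_coe]
    exact lie_mem_right ℂ k I x b hb
  have hEZ : E ≤ center ℂ k := by
    intro x hx y
    have h1 : ⁅y, x⁆ ∈ D := LieSubmodule.lie_mem_lie (by trivial) (by trivial)
    have h2 : ⁅y, x⁆ ∈ E := lie_mem_right ℂ k E y x hx
    have h3 : ⁅y, x⁆ ∈ D ⊓ E := ⟨h1, h2⟩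
    rwa [hE.inf_eq_bot, LieSubmodule.mem_bot] at h3
  have hc : IsCompl (center ℂ k) D := by
    refine ⟨hI.disjoint.mono_right hDI, codisjoint_iff.mpr (top_le_iff.mp ?_)⟩
    rw [← hE.sup_eq_top, sup_comm]
    exact sup_le_sup_right hEZ D
  refine ⟨?_, ?_⟩
  · rw [disjoint_iff, ← LieSubmodule.inf_toSubmodule, hc.inf_eq_bot,
      LieSubmodule.bot_toSubmodule]
  · rw [codisjoint_iff, ← LieSubmodule.sup_toSubmodule, hc.sup_eq_top,
      LieSubmodule.top_toSubmodule]

/-- A functional `ν` on the centre of a reductive Lie algebra `k`, extended to `k` by zero on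
`[k, k]`. -/
def extendCenter [IsReductive k] (ν : Module.Dual ℂ (center ℂ k)) : Module.Dual ℂ k :=
  ν ∘ₗ (center ℂ k).toSubmodule.projectionOnto _ (isCompl_center k)

theorem extendCenter_lie [IsReductive k] (ν : Module.Dual ℂ (center ℂ k)) (x y : k) :
    extendCenter ν ⁅x, y⁆ = 0 := by
  have h : ⁅x, y⁆ ∈ (⁅(⊤ : LieIdeal ℂ k), (⊤ : LieIdeal ℂ k)⁆).toSubmodule :=
    LieSubmodule.lie_mem_lie (by trivial) (by trivial)
  simp only [extendCenter, LinearMap.comp_apply]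
  rw [Submodule.projectionOnto_apply_of_mem_right _ h]
  exact map_zero ν

/-- The nilpotent shift `v_i ↦ v_{i+1}`, `v_n ↦ 0` on `ℂ^n`. -/
def shift (n : ℕ) : (Fin n → ℂ) →ₗ[ℂ] (Fin n → ℂ) where
  toFun f i := if h : 0 < i.val then f ⟨i.val - 1, by omega⟩ else 0
  map_add' f f' := by ext i; by_cases h : 0 < i.val <;> simp [h]
  map_smul' c f := by ext i; by_cases h : 0 < i.val <;> simp [h]

/-- The Jordan-type module `J_n(ν)` with basis `v_1, …, v_n`, on which `[k, k]` acts by zero and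
`h v_i = ν(h) v_{i+1}`, `h v_n = 0` for `h` in the centre of `k`. -/
def Jordan [IsReductive k] (n : ℕ) (_ν : Module.Dual ℂ (center ℂ k)) : Type := Fin n → ℂ

variable [IsReductive k] (n : ℕ) (ν : Module.Dual ℂ (center ℂ k))

instance : AddCommGroup (Jordan n ν) := inferInstanceAs (AddCommGroup (Fin n → ℂ))

instance : Module ℂ (Jordan n ν) := inferInstanceAs (Module ℂ (Fin n → ℂ))

/-- The shift, as an operator on `J_n(ν)`. -/
def Jordan.shift : Jordan n ν →ₗ[ℂ] Jordan n ν := SuperLie.shift n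

instance : LieRingModule k (Jordan n ν) where
  bracket x f := extendCenter ν x • Jordan.shift n ν f
  add_lie x y f := by
    rw [map_add, add_smul]
  lie_add x f f' := by
    rw [map_add, smul_add]
  leibniz_lie x y f := by
    change extendCenter ν x • Jordan.shift n ν (extendCenter ν y • Jordan.shift n ν f) =
      extendCenter ν ⁅x, y⁆ • Jordan.shift n ν f +
        extendCenter ν y • Jordan.shift n ν (extendCenter ν x • Jordan.shift n ν f)
    rw [extendCenter_lie, zero_smul, zero_add, map_smul, map_smul, smul_comm]

theorem Jordan.lie_def (x : k) (f : Jordan n ν) :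
    ⁅x, f⁆ = extendCenter ν x • Jordan.shift n ν f := rfl

instance : LieModule ℂ k (Jordan n ν) where
  smul_lie c x f := by simp only [Jordan.lie_def, map_smul, smul_eq_mul, mul_smul]
  lie_smul c x f := by simp only [Jordan.lie_def, map_smul, smul_comm c]

end jordan

/-! ### Self-extensions and the map `Υ` -/

section ext

variable (g : Type u) [AddCommGroup g] [Module ℂ g] [LieSuperalgebra g]
variable (M : Type w) [AddCommGroup M] [Module (U g) M] [SuperModule g M]

/-- A self-extension `0 → M → N → M → 0` of a `g`-supermodule `M` (with even maps). -/
structure SelfExt where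
  N : Type w
  [grp : AddCommGroup N]
  [vec : Module ℂ N]
  [mod : Module (U g) N]
  [tower : IsScalarTower ℂ (U g) N]
  [super : SuperModule g N]
  φ₁ : M →ₗ[U g] N
  φ₂ : N →ₗ[U g] M
  even₁ : IsEvenMap φ₁
  even₂ : IsEvenMap φ₂
  injective : Function.Injective φ₁
  surjective : Function.Surjective φ₂
  exact : Function.Exact φ₁ φ₂

attribute [instance] SelfExt.grp SelfExt.vec SelfExt.mod SelfExt.tower SelfExt.super

variable {g M}

/-- Equivalence of self-extensions: an even isomorphism of the middle terms inducing the identity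
on both copies of `M`. -/
def SelfExt.Equiv (E E' : SelfExt g M) : Prop :=
  ∃ e : E.N ≃ₗ[U g] E'.N, IsEvenMap e.toLinearMap ∧
    (∀ m, e (E.φ₁ m) = E'.φ₁ m) ∧ ∀ n, E'.φ₂ (e n) = E.φ₂ n

theorem SelfExt.Equiv.symm {E E' : SelfExt g M} (h : E.Equiv E') : E'.Equiv E := by
  obtain ⟨e, h0, h1, h2⟩ := h
  refine ⟨e.symm, fun n => ?_, fun m => ?_, fun n => ?_⟩
  · have := h0 (e.symm n)
    simp only [LinearEquiv.coe_coe, LinearEquiv.apply_symm_apply] at this ⊢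
    rw [← this, LinearEquiv.symm_apply_apply]
  · rw [← h1, LinearEquiv.symm_apply_apply]
  · rw [← h2, LinearEquiv.apply_symm_apply]

instance SelfExt.setoid : Setoid (SelfExt g M) where
  r := SelfExt.Equiv
  iseqv :=
    { refl := fun E => ⟨LinearEquiv.refl _ _, fun _ => rfl, fun _ => rfl, fun _ => rfl⟩
      symm := SelfExt.Equiv.symm
      trans := by
        rintro E E' E'' ⟨e, h0, h1, h2⟩ ⟨e', h0', h1', h2'⟩
        refine ⟨e.trans e', fun n => ?_, fun m => ?_, fun n => ?_⟩
        · exact (congrArg e' (h0 n)).trans (h0' (e n))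
        · simp [h1, h1']
        · simp [h2, h2'] }

variable (g M) in
/-- `Ext¹_g(M, M)`: the set of equivalence classes of self-extensions of `M`. -/
def Ext1 : Type _ := Quotient (SelfExt.setoid (g := g) (M := M))

variable (H : LieSubalgebra ℂ (EvenPart g)) (lam : Module.Dual ℂ H)

/-- Membership in the generalized weight space `N_λ`. -/
def InGenWeight (N : Type w) [AddCommGroup N] [Module (U g) N] (n : N) : Prop :=
  ∀ h : H, ∃ s : ℕ, (ι h.1.1 - algebraMap ℂ (U g) (lam h)) ^ s • n = 0

/-- `μ` is a value of `Υ_M` at the self-extension `0 → M → N → M → 0`: for `v = φ₁ (v_λ)` and some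
`v' ∈ N_λ` with `φ₂ v' = v_λ` one has `h v' = λ(h) v' + μ(h) v` for all `h`. -/
def SelfExt.IsValue (vlam : M) (E : SelfExt g M) (μ : Module.Dual ℂ H) : Prop :=
  ∃ v' : E.N, InGenWeight H lam E.N v' ∧ E.φ₂ v' = vlam ∧
    ∀ h : H, ι h.1.1 • v' = lam h • v' + μ h • E.φ₁ vlam

theorem algebraMap_smul_eq {N : Type w} [AddCommGroup N] [Module ℂ N] [Module (U g) N]
    [IsScalarTower ℂ (U g) N] (c : ℂ) (n : N) : algebraMap ℂ (U g) c • n = c • n :=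
  algebraMap_smul (U g) c n

theorem SelfExt.IsValue.congr {vlam : M} {E E' : SelfExt g M} (hE : E.Equiv E')
    {μ : Module.Dual ℂ H} (h : E.IsValue H lam vlam μ) : E'.IsValue H lam vlam μ := by
  obtain ⟨e, -, h1, h2⟩ := hE
  obtain ⟨v', hw, hv, hμ⟩ := h
  refine ⟨e v', fun x => ?_, by rw [h2, hv], fun x => ?_⟩
  · obtain ⟨s, hs⟩ := hw x
    exact ⟨s, by rw [← map_smul, hs, map_zero]⟩
  · have hc : ∀ (c : ℂ) (n : E.N), e (c • n) = c • e n := fun c n => by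
      rw [← algebraMap_smul_eq (g := g) c n, map_smul, algebraMap_smul_eq]
    rw [← map_smul, hμ x, map_add, hc, hc, h1]

open Classical in
/-- The map `Υ_M : Ext¹_g(M, M) → h^*` of a module `M` with highest weight `λ` and highest weight
vector `v_λ` (it is given the value `0` where no `μ` as in its definition exists). -/
def Upsilon (vlam : M) : Ext1 g M → Module.Dual ℂ H :=
  Quotient.lift
    (fun E : SelfExt g M => if h : ∃ μ, E.IsValue H lam vlam μ then h.choose else 0) (by
      intro E E' hE
      have : (fun μ => E.IsValue H lam vlam μ) = fun μ => E'.IsValue H lam vlam μ :=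
        funext fun μ => propext
          ⟨fun h => h.congr H lam hE, fun h => h.congr H lam (SelfExt.Equiv.symm hE)⟩
      change (if h : ∃ μ, (fun μ => E.IsValue H lam vlam μ) μ then h.choose else 0) =
        if h : ∃ μ, (fun μ => E'.IsValue H lam vlam μ) μ then h.choose else 0
      rw [this])

end ext

/-! ### Highest weight modules -/

section highest

variable {g : Type u} [AddCommGroup g] [Module ℂ g] [LieSuperalgebra g]

/-- `B` is a Borel subalgebra (a maximal solvable subalgebra) of `k` containing `H`. -/
structure IsBorel {k : Type u} [LieRing k] [LieAlgebra ℂ k] (H B : LieSubalgebra ℂ k) : Prop where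
  le : H ≤ B
  solvable : LieAlgebra.IsSolvable B
  maximal : ∀ B' : LieSubalgebra ℂ k, LieAlgebra.IsSolvable B' → B ≤ B' → B' = B

/-- `L` is a module of highest weight `λ` over the Lie algebra `k`, with highest weight vector
`v`, for the Borel subalgebra `B ⊇ H`: `v` is nonzero, is killed by `[B, B]`, has weight `λ` and
generates `L`. -/
structure IsHighestWeight {k : Type u} [LieRing k] [LieAlgebra ℂ k] (H B : LieSubalgebra ℂ k)
    (L : Type v) [AddCommGroup L] [Module ℂ L] [LieRingModule k L] [LieModule ℂ k L]
    (lam : Module.Dual ℂ H) (v : L) : Prop where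
  ne_zero : v ≠ 0
  weight : ∀ h : H, ⁅(h : k), v⁆ = lam h • v
  killed : ∀ x ∈ B, ∀ y ∈ B, ⁅⁅x, y⁆, v⁆ = 0
  generates : LieSubmodule.lieSpan ℂ k {v} = ⊤

/-- `N` is a `g`-module of highest weight `λ` with highest weight vector `v`, for the Borel
subalgebra `B + g_1` of `g`, where `B ⊇ H` is a Borel subalgebra of `g_0`. -/
structure IsSuperHighestWeight (T : TypeI g) (H B : LieSubalgebra ℂ (EvenPart g))
    (N : Type v) [AddCommGroup N] [Module ℂ N] [Module (U g) N]
    (lam : Module.Dual ℂ H) (v : N) : Prop where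
  ne_zero : v ≠ 0
  weight : ∀ h : H, ι h.1.1 • v = lam h • v
  killed_even : ∀ x ∈ B, ∀ y ∈ B, ι (⁅x, y⁆ : EvenPart g).1 • v = 0
  killed_pos : ∀ b ∈ T.pos, ι b • v = 0
  generates : Submodule.span (U g) {v} = ⊤

end highest

end SuperLie

end

open SuperLie

/-! As a vector space `K(M)` is `Λ(g_{-1}) ⊗ M`. Instead of invoking a PBW theorem, `g` is made to
act on `Λ(g_{-1}) ⊗ M` directly: `g_{-1}` by exterior multiplication, `g_0` by the Leibniz rule, and
`g_1` by the recursion `x(y ∧ t) = [x,y]t - y ∧ xt` starting from `x(1 ⊗ m) = 0`. Once the super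
bracket relations are checked (`extOp_extOp`), the universal property yields mutually inverse maps
(`Kac.equivExt`). Since tensoring over a field is exact, so is `K` (`Kac.exact_map`), and projection
to exterior degree zero gives a `g_0`-linear map `K(M) → M` with kernel `g_{-1}K(M)`.

Filtration: the shift of `J_n(ν)` commutes with `g_0` and induces an endomorphism `σ` of `K(L;n;ν)`
with `ker σ^j' = im σ^j` for `j + j' = n` and `ker σ ≅ K(L)`. Put `F_i = ker σ^i`; then `σ^i`
identifies `F_{i+1}/F_i` with `ker σ`.

Indecomposability: one argument serves twice. Let `π : X → M` be onto with kernel `∑ Y_i X`, where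
all sufficiently long words in the operators `Y_i` vanish, and let `X = S ⊕ T` with `S`, `T` stable
under the `Y_i`. Then `π(S)` and `π(T)` are complementary in `M`, and `π(S) = 0` forces `S = ∑ Y_i
S`, hence `S = 0`. This is applied to `K(M) → M` with the action of `g_{-1}`, and to `L ⊗ J_n(ν) →
L` with the shift. Submodules of the latter are shift-stable because `z - c` acts as `ν(z)` times
the shift.

Image of `Υ`: the coroots span `h ∩ [g_0, g_0]`, and a coroot belongs to an `sl₂`-triple, so it acts
semisimply on the finite-dimensional middle term and a value vanishes on it
(`eq_zero_of_mem_derivedIdeal`). On the centre a value is unique, because after projecting to `L` a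
central element is a scalar (`SelfExt.IsValue.unique`). Conversely `K(L;2;ν)` has the value `ν`,
seen on `v ⊗ v_1` (`isValue_kacExt`). -/

noncomputable section

set_option linter.unusedSectionVars false

namespace SuperLie

/-! ### Recursion, finiteness and nilpotency for `Λ(V) ⊗ M` -/

section exterior

variable {V M : Type*} [AddCommGroup V] [Module ℂ V] [AddCommGroup M] [Module ℂ M]

variable (V M) in
/-- The space `Λ(V) ⊗ M`. -/
def ExtMod : Type _ := ExteriorAlgebra ℂ V ⊗[ℂ] M

instance : AddCommGroup (ExtMod V M) :=
  inferInstanceAs (AddCommGroup (ExteriorAlgebra ℂ V ⊗[ℂ] M))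

instance : Module ℂ (ExtMod V M) := inferInstanceAs (Module ℂ (ExteriorAlgebra ℂ V ⊗[ℂ] M))

namespace ExtMod

variable (V M) in
/-- The identification of `ExtMod V M` with the tensor product. -/
def equiv : ExtMod V M ≃ₗ[ℂ] ExteriorAlgebra ℂ V ⊗[ℂ] M := LinearEquiv.refl ℂ _

variable (V M) in
/-- The bilinear map `(w, m) ↦ w ⊗ m`. -/
def tmul : ExteriorAlgebra ℂ V →ₗ[ℂ] M →ₗ[ℂ] ExtMod V M := TensorProduct.mk ℂ _ M

variable (V) in
/-- The inclusion `m ↦ 1 ⊗ m`. -/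
def one : M →ₗ[ℂ] ExtMod V M := tmul V M 1

theorem induction_tmul {P : ExtMod V M → Prop} (t : ExtMod V M)
    (tmul : ∀ w m, P (tmul V M w m)) (add : ∀ s t, P s → P t → P (s + t)) : P t :=
  TensorProduct.induction_on t
    (by have h := tmul 0 0; rw [map_zero] at h; exact h) tmul add

variable (V M) in
/-- Exterior multiplication `y ∧ -` on `Λ(V) ⊗ M`. -/
def wedge : V →ₗ[ℂ] ExtMod V M →ₗ[ℂ] ExtMod V M :=
  LinearMap.rTensorHom M ∘ₗ LinearMap.mul ℂ (ExteriorAlgebra ℂ V) ∘ₗ ExteriorAlgebra.ι ℂ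

theorem wedge_tmul (y : V) (w : ExteriorAlgebra ℂ V) (m : M) :
    wedge V M y (tmul V M w m) = tmul V M (ExteriorAlgebra.ι ℂ y * w) m := rfl

theorem wedge_wedge_self (y : V) (t : ExtMod V M) : wedge V M y (wedge V M y t) = 0 := by
  induction t using induction_tmul with
  | add s t hs ht => rw [map_add, map_add, hs, ht, add_zero]
  | tmul w m =>
    rw [wedge_tmul, wedge_tmul, ← mul_assoc, ExteriorAlgebra.ι_sq_zero, zero_mul, map_zero,
      LinearMap.zero_apply]

theorem wedge_wedge_swap (x y : V) (t : ExtMod V M) :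
    wedge V M x (wedge V M y t) = -wedge V M y (wedge V M x t) := by
  have h := wedge_wedge_self (x + y) t
  simp only [map_add, LinearMap.add_apply, wedge_wedge_self, zero_add, add_zero] at h
  exact eq_neg_of_add_eq_zero_right h

theorem wedge_induction {P : ExtMod V M → Prop} (t : ExtMod V M)
    (one : ∀ m, P (one V m)) (add : ∀ s t, P s → P t → P (s + t))
    (wedge : ∀ y t, P t → P (wedge V M y t)) : P t := by
  induction t using induction_tmul with
  | add s t hs ht => exact add s t hs ht
  | tmul w m =>
    induction w using CliffordAlgebra.left_induction generalizing m with
    | algebraMap r =>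
      have : tmul V M (algebraMap ℂ _ r) m = ExtMod.one V (r • m) := by
        rw [Algebra.algebraMap_eq_smul_one, map_smul, LinearMap.smul_apply, map_smul]; rfl
      rw [this]
      exact one _
    | add x y hx hy => rw [map_add]; exact add _ _ (hx m) (hy m)
    | ι_mul x y hx => exact wedge y _ (hx m)

/-- Recursion on `Λ(V) ⊗ M`: an operator `P` is determined by its values on `1 ⊗ M` and by its
(anti)commutators with exterior multiplications. -/
theorem exists_wedge_rec {W : Type*} [AddCommGroup W] [Module ℂ W] (Y : V →ₗ[ℂ] W →ₗ[ℂ] W)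
    (hY : ∀ y w, Y y (Y y w) = 0) (s : ℂ) (b : M →ₗ[ℂ] W)
    (c : V →ₗ[ℂ] ExtMod V M →ₗ[ℂ] W)
    (hc : ∀ y t, c y (wedge V M y t) + s • Y y (c y t) = 0) :
    ∃ P : ExtMod V M →ₗ[ℂ] W, (∀ m, P (one V m) = b m) ∧
      ∀ y t, P (wedge V M y t) = c y t + s • Y y (P t) := by
  -- `P` is built in curried form `Λ(V) → (M → W)` by `CliffordAlgebra.foldr'` for the zero form.
  -- The pair carries the remaining factor along with the value on it, as `c` depends on the former.
  let f : V →ₗ[ℂ] (ExteriorAlgebra ℂ V × (M →ₗ[ℂ] W)) →ₗ[ℂ] (M →ₗ[ℂ] W) :=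
    LinearMap.mk₂ ℂ (fun y p => c y ∘ₗ tmul V M p.1 + s • (Y y ∘ₗ p.2))
      (fun y y' p => by ext m; simp; abel)
      (fun r y p => by ext m; simp [smul_comm s r])
      (fun y p p' => by ext m; simp; abel)
      (fun r y p => by ext m; simp [smul_comm s r])
  -- Compatibility with `y ∧ y = 0`: the cross terms cancel by `hc`, and the term in `s²` vanishes
  -- by `hY`.
  have hf : ∀ y x φ, f y (ExteriorAlgebra.ι ℂ y * x, f y (x, φ)) =
      (0 : QuadraticForm ℂ V) y • φ := by
    intro y x φ
    ext m
    simp only [f, LinearMap.mk₂_apply, LinearMap.add_apply, LinearMap.comp_apply,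
      LinearMap.smul_apply, zero_apply, zero_smul,
      LinearMap.zero_apply, map_add, map_smul, hY, smul_zero, add_zero]
    exact hc y (tmul V M x m)
  let P : ExtMod V M →ₗ[ℂ] W := TensorProduct.lift (CliffordAlgebra.foldr' (0 : QuadraticForm ℂ V) f hf b)
  refine ⟨P, fun m => ?_, fun y t => ?_⟩
  · have h := CliffordAlgebra.foldr'_algebraMap (0 : QuadraticForm ℂ V) f hf b 1
    rw [map_one, one_smul] at h
    exact congrArg (fun φ : M →ₗ[ℂ] W => φ m) h
  · induction t using induction_tmul with
    | add s t hs ht => simp only [map_add, hs, ht, smul_add]; abel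
    | tmul w m =>
      have h := CliffordAlgebra.foldr'_ι_mul (0 : QuadraticForm ℂ V) f hf b y w
      exact congrArg (fun φ : M →ₗ[ℂ] W => φ m) h

end ExtMod

/-- More than `dim V` vectors are linearly dependent, and alternating maps vanish on dependent
families. This is the source of the nilpotency of `g_{-1}` on Kac modules. -/
theorem prod_ι_eq_zero [FiniteDimensional ℂ V] (l : List V) (hl : Module.finrank ℂ V < l.length) :
    (l.map (ExteriorAlgebra.ι ℂ)).prod = 0 := by
  have h : ExteriorAlgebra.ιMulti ℂ l.length l.get = 0 := by
    refine AlternatingMap.map_linearDependent _ _ fun hli => ?_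
    have := hli.fintype_card_le_finrank
    rw [Fintype.card_fin] at this
    omega
  rw [ExteriorAlgebra.ιMulti_apply] at h
  rw [← h]
  congr 1
  conv_lhs => rw [← List.ofFn_get l, List.map_ofFn]
  rfl

instance finite_exteriorAlgebra [FiniteDimensional ℂ V] :
    FiniteDimensional ℂ (ExteriorAlgebra ℂ V) := by
  have h : (⊤ : Submodule ℂ (ExteriorAlgebra ℂ V)) =
      ⨆ i ∈ Finset.range (Module.finrank ℂ V + 1), ⋀[ℂ]^i V := by
    rw [eq_comm, eq_top_iff, ← ExteriorAlgebra.ιMulti_span ℂ V, Submodule.span_le]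
    rintro _ ⟨⟨n, v⟩, rfl⟩
    by_cases hn : n < Module.finrank ℂ V + 1
    · exact Submodule.mem_iSup_of_mem n (Submodule.mem_iSup_of_mem (Finset.mem_range.mpr hn)
        (ExteriorAlgebra.ιMulti_range ℂ n ⟨v, rfl⟩))
    · have : ExteriorAlgebra.ιMulti ℂ n v = 0 :=
        AlternatingMap.map_linearDependent _ _ fun hli => by
          have := hli.fintype_card_le_finrank
          rw [Fintype.card_fin] at this
          omega
      simp only [this]
      exact zero_mem _
  refine ⟨?_⟩
  rw [h]
  exact Submodule.fg_biSup _ _ fun i _ => Module.Finite.iff_fg.mp inferInstance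

theorem ExtMod.foldr_wedge_eq_zero [FiniteDimensional ℂ V] (l : List V)
    (hl : Module.finrank ℂ V < l.length) (t : ExtMod V M) :
    l.foldr (fun y s => wedge V M y s) t = 0 := by
  have h : ∀ (l : List V) (w : ExteriorAlgebra ℂ V) (m : M),
      l.foldr (fun y s => wedge V M y s) (tmul V M w m) =
        tmul V M ((l.map (ExteriorAlgebra.ι ℂ)).prod * w) m := by
    intro l w m
    induction l with
    | nil => simp
    | cons y l ih => rw [List.foldr_cons, ih, wedge_tmul, List.map_cons, List.prod_cons, mul_assoc]
  have hadd : ∀ (l : List V) (s t : ExtMod V M), l.foldr (fun y s => wedge V M y s) (s + t) =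
      l.foldr (fun y s => wedge V M y s) s + l.foldr (fun y s => wedge V M y s) t := by
    intro l s t
    induction l with
    | nil => rfl
    | cons y l ih => simp only [List.foldr_cons, ih, map_add]
  induction t using induction_tmul with
  | tmul w m => rw [h, prod_ι_eq_zero l hl, zero_mul, map_zero, LinearMap.zero_apply]
  | add s t hs ht => rw [hadd, hs, ht, add_zero]

instance [FiniteDimensional ℂ V] [FiniteDimensional ℂ M] : FiniteDimensional ℂ (ExtMod V M) :=
  Module.Finite.equiv (ExtMod.equiv V M).symm

end exterior

/-! ### Induction on `U(g)` -/

section induction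

variable {g : Type*} [AddCommGroup g] [Module ℂ g] [LieSuperalgebra g]

theorem U_induction {P : U g → Prop} (u : U g) (algebraMap : ∀ c, P (algebraMap ℂ (U g) c))
    (ι : ∀ x, P (ι x)) (add : ∀ a b, P a → P b → P (a + b)) (mul : ∀ a b, P a → P b → P (a * b)) :
    P u := by
  obtain ⟨t, rfl⟩ := RingQuot.mkAlgHom_surjective ℂ (URel g) u
  induction t using TensorAlgebra.induction with
  | algebraMap r => rw [AlgHom.commutes]; exact algebraMap r
  | ι x => exact ι x
  | mul a b ha hb => rw [map_mul]; exact mul _ _ ha hb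
  | add a b ha hb => rw [map_add]; exact add _ _ ha hb

/-- A linear map that commutes with the action of `g` is `U(g)`-linear. -/
def linearOfComm {N N' : Type*} [AddCommGroup N] [Module ℂ N] [Module (U g) N]
    [IsScalarTower ℂ (U g) N] [AddCommGroup N'] [Module ℂ N'] [Module (U g) N']
    [IsScalarTower ℂ (U g) N'] (f : N →ₗ[ℂ] N') (hf : ∀ (x : g) n, f (ι x • n) = ι x • f n) :
    N →ₗ[U g] N' where
  toFun := f
  map_add' := map_add f
  map_smul' u n := by
    induction u using U_induction generalizing n with
    | algebraMap c => simp [algebraMap_smul]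
    | ι x => exact hf x n
    | add a b ha hb => rw [add_smul, map_add, ha, hb]; exact (add_smul _ _ _).symm
    | mul a b ha hb => rw [mul_smul, ha, hb]; exact (mul_smul _ _ _).symm

end induction

/-! ### The action of `g` on `Λ(g_{-1}) ⊗ M` -/

section rep

open LieSuperalgebra ExtMod

variable {g : Type*} [AddCommGroup g] [Module ℂ g] [LieSuperalgebra g] (T : TypeI g)

namespace TypeI

theorem neg_le : T.neg ≤ part (g := g) 1 := T.sup_eq ▸ le_sup_left

theorem pos_le : T.pos ≤ part (g := g) 1 := T.sup_eq ▸ le_sup_right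

theorem isCompl_pos : IsCompl T.pos (part (g := g) 0 ⊔ T.neg) := by
  refine ⟨?_, ?_⟩
  · rw [disjoint_iff, eq_bot_iff]
    rintro x ⟨hx, hx'⟩
    obtain ⟨a, ha, y, hy, rfl⟩ := Submodule.mem_sup.mp hx'
    have ha1 : a ∈ part (g := g) 1 := by
      have := sub_mem (T.pos_le hx) (T.neg_le hy)
      rwa [add_sub_cancel_right] at this
    have ha0 : a = 0 := by
      have := isCompl (g := g).inf_eq_bot.le ⟨ha, ha1⟩
      simpa using this
    subst ha0
    rw [zero_add] at hx ⊢
    have := T.disjoint.le ⟨hy, hx⟩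
    exact this
  · rw [codisjoint_iff, sup_comm, sup_assoc, T.sup_eq, isCompl.sup_eq_top]

theorem isCompl_neg : IsCompl T.neg (part (g := g) 0 ⊔ T.pos) := by
  refine ⟨?_, ?_⟩
  · rw [disjoint_iff, eq_bot_iff]
    rintro x ⟨hx, hx'⟩
    obtain ⟨a, ha, y, hy, rfl⟩ := Submodule.mem_sup.mp hx'
    have ha1 : a ∈ part (g := g) 1 := by
      have := sub_mem (T.neg_le hx) (T.pos_le hy)
      rwa [add_sub_cancel_right] at this
    have ha0 : a = 0 := by
      have := isCompl (g := g).inf_eq_bot.le ⟨ha, ha1⟩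
      simpa using this
    subst ha0
    rw [zero_add] at hx ⊢
    exact T.disjoint.le ⟨hx, hy⟩
  · rw [codisjoint_iff, sup_comm, sup_assoc, sup_comm T.pos, T.sup_eq, isCompl.sup_eq_top]

/-- The action of an even element on `g_{-1}`. -/
def evenNeg (a : EvenPart g) : T.neg →ₗ[ℂ] T.neg := (br a.1).restrict (T.even_neg a)

/-- The bracket `g_1 × g_{-1} → g_0`. -/
def posNeg (x : T.pos) : T.neg →ₗ[ℂ] EvenPart g :=
  LinearMap.codRestrict (part 0) (br x.1 ∘ₗ T.neg.subtype) fun y =>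
    br_mem 1 1 x.1 y.1 (T.pos_le x.2) (T.neg_le y.2)

@[simp] theorem coe_evenNeg (a : EvenPart g) (y : T.neg) : (T.evenNeg a y : g) = br a.1 y.1 := rfl

@[simp] theorem coe_posNeg (x : T.pos) (y : T.neg) : (T.posNeg x y : g) = br x.1 y.1 := rfl

end TypeI

theorem sgn_one_one : sgn 1 1 = -1 := by simp [sgn, ZMod.val_one]

theorem jacobi_even (a : EvenPart g) (y z : g) :
    br a.1 (br y z) = br (br a.1 y) z + br y (br a.1 z) := by
  obtain ⟨y0, hy0, y1, hy1, rfl⟩ := Submodule.mem_sup.mp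
    (show y ∈ part (g := g) 0 ⊔ part 1 by rw [isCompl.sup_eq_top]; trivial)
  have h0 := jacobi 0 0 a.1 y0 z a.2 hy0
  have h1 := jacobi 0 1 a.1 y1 z a.2 hy1
  rw [sgn_zero_left, one_smul] at h0 h1
  simp only [map_add, LinearMap.add_apply, h0, h1]
  abel

/-- The Jacobi identity for `x, y, y` with `[y,y] = 0` gives twice this bracket. It is exactly the
consistency condition for the recursion defining the action of `g_1`. -/
theorem br_br_neg_self (x : T.pos) (y : T.neg) : br (br x.1 y.1) y.1 = 0 := by
  have h := jacobi 1 1 x.1 y.1 y.1 (T.pos_le x.2) (T.neg_le y.2)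
  have h2 := skew 1 0 y.1 (br x.1 y.1) (T.neg_le y.2) (T.posNeg x y).2
  rw [T.neg_neg _ y.2 _ y.2, map_zero, sgn_one_one, h2, sgn_zero_right, one_smul, neg_smul,
    one_smul, neg_neg, ← two_smul ℂ] at h
  exact (smul_eq_zero.mp h.symm).resolve_left two_ne_zero

/-- The mirror image, from `[x,x] = 0`; it makes each `x` in `g_1` act with square zero. -/
theorem br_br_pos_self (x : T.pos) (y : T.neg) : br (br x.1 y.1) x.1 = 0 := by
  have h := jacobi 1 1 x.1 x.1 y.1 (T.pos_le x.2) (T.pos_le x.2)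
  have h2 := skew 1 0 x.1 (br x.1 y.1) (T.pos_le x.2) (T.posNeg x y).2
  rw [T.pos_pos _ x.2 _ x.2, map_zero, LinearMap.zero_apply, sgn_one_one, h2, sgn_zero_right,
    one_smul, neg_smul, one_smul, neg_neg, zero_add, neg_eq_iff_add_eq_zero, ← two_smul ℂ] at h
  exact (smul_eq_zero.mp h).resolve_left two_ne_zero

variable (M : Type*) [AddCommGroup M] [Module ℂ M] [LieRingModule (EvenPart g) M]
  [LieModule ℂ (EvenPart g) M]

/-- The Leibniz extension of `ad a` on `g_{-1}` and of `a` on `M`. It respects `y ∧ y = 0` because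
`[a,y]` and `y` anticommute in the exterior algebra. -/
theorem exists_evenOp (a : EvenPart g) :
    ∃ P : ExtMod T.neg M →ₗ[ℂ] ExtMod T.neg M,
      (∀ m, P (one T.neg m) = one T.neg ⁅a, m⁆) ∧
      ∀ y t, P (wedge T.neg M y t) = wedge T.neg M (T.evenNeg a y) t + wedge T.neg M y (P t) := by
  obtain ⟨P, h1, h2⟩ := exists_wedge_rec (wedge T.neg M) wedge_wedge_self 1
    (one T.neg ∘ₗ (LieModule.toEnd ℂ (EvenPart g) M a))
    (wedge T.neg M ∘ₗ T.evenNeg a) (fun y t => by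
      rw [one_smul, LinearMap.comp_apply, wedge_wedge_swap, neg_add_cancel])
  exact ⟨P, h1, fun y t => by rw [h2, one_smul]; rfl⟩

/-- The action of `g_0` on `Λ(g_{-1}) ⊗ M`. -/
def evenOp (a : EvenPart g) : ExtMod T.neg M →ₗ[ℂ] ExtMod T.neg M := (exists_evenOp T M a).choose

theorem evenOp_one (a : EvenPart g) (m : M) : evenOp T M a (one T.neg m) = one T.neg ⁅a, m⁆ :=
  (exists_evenOp T M a).choose_spec.1 m

theorem evenOp_wedge (a : EvenPart g) (y : T.neg) (t : ExtMod T.neg M) :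
    evenOp T M a (wedge T.neg M y t) =
      wedge T.neg M (T.evenNeg a y) t + wedge T.neg M y (evenOp T M a t) :=
  (exists_evenOp T M a).choose_spec.2 y t

theorem evenOp_add (a b : EvenPart g) : evenOp T M (a + b) = evenOp T M a + evenOp T M b := by
  refine LinearMap.ext fun t => ?_
  induction t using wedge_induction with
  | one m => rw [LinearMap.add_apply, evenOp_one, evenOp_one, evenOp_one, add_lie, map_add]
  | add s t hs ht => rw [map_add, map_add, hs, ht]
  | wedge y t ht =>
    have : T.evenNeg (a + b) y = T.evenNeg a y + T.evenNeg b y := Subtype.ext (by simp)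
    simp only [LinearMap.add_apply, evenOp_wedge, map_add, this] at ht ⊢
    rw [ht, map_add]
    abel

theorem evenOp_smul (c : ℂ) (a : EvenPart g) : evenOp T M (c • a) = c • evenOp T M a := by
  refine LinearMap.ext fun t => ?_
  induction t using wedge_induction with
  | one m => rw [LinearMap.smul_apply, evenOp_one, evenOp_one, smul_lie, map_smul]
  | add s t hs ht => rw [map_add, map_add, hs, ht]
  | wedge y t ht =>
    have : T.evenNeg (c • a) y = c • T.evenNeg a y := Subtype.ext (by simp)
    simp only [LinearMap.smul_apply, evenOp_wedge, map_smul, this] at ht ⊢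
    rw [ht, map_smul, smul_add]

/-- The action of `g_0` on `Λ(g_{-1}) ⊗ M`, as a linear map. -/
def evenOpHom : EvenPart g →ₗ[ℂ] ExtMod T.neg M →ₗ[ℂ] ExtMod T.neg M where
  toFun := evenOp T M
  map_add' := evenOp_add T M
  map_smul' := evenOp_smul T M

/-- The recursion is the only possible one, being the relation `xy + yx = [x,y]` of `U(g)`. Applied
to `y ∧ y ∧ t` it leaves the term `[[x,y],y] ∧ t`, which vanishes. -/
theorem exists_posOp (x : T.pos) :
    ∃ P : ExtMod T.neg M →ₗ[ℂ] ExtMod T.neg M,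
      (∀ m, P (one T.neg m) = 0) ∧
      ∀ y t, P (wedge T.neg M y t) = evenOp T M (T.posNeg x y) t - wedge T.neg M y (P t) := by
  obtain ⟨P, h1, h2⟩ := exists_wedge_rec (wedge T.neg M) wedge_wedge_self (-1) 0
    (evenOpHom T M ∘ₗ T.posNeg x) (fun y t => by
      have : T.evenNeg (T.posNeg x y) y = 0 := Subtype.ext (br_br_neg_self T x y)
      change evenOp T M _ _ + _ • wedge T.neg M y (evenOp T M _ _) = 0
      rw [evenOp_wedge, this]
      simp)
  exact ⟨P, h1, fun y t => by rw [h2, neg_one_smul, sub_eq_add_neg]; rfl⟩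

/-- The action of `g_1` on `Λ(g_{-1}) ⊗ M`. -/
def posOp (x : T.pos) : ExtMod T.neg M →ₗ[ℂ] ExtMod T.neg M := (exists_posOp T M x).choose

theorem posOp_one (x : T.pos) (m : M) : posOp T M x (one T.neg m) = 0 :=
  (exists_posOp T M x).choose_spec.1 m

theorem posOp_wedge (x : T.pos) (y : T.neg) (t : ExtMod T.neg M) :
    posOp T M x (wedge T.neg M y t) =
      evenOp T M (T.posNeg x y) t - wedge T.neg M y (posOp T M x t) :=
  (exists_posOp T M x).choose_spec.2 y t

theorem posOp_add (a b : T.pos) : posOp T M (a + b) = posOp T M a + posOp T M b := by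
  refine LinearMap.ext fun t => ?_
  induction t using wedge_induction with
  | one m => rw [LinearMap.add_apply, posOp_one, posOp_one, posOp_one, add_zero]
  | add s t hs ht => rw [map_add, map_add, hs, ht]
  | wedge y t ht =>
    have : T.posNeg (a + b) y = T.posNeg a y + T.posNeg b y := Subtype.ext (by simp)
    simp only [LinearMap.add_apply, posOp_wedge, this, evenOp_add] at ht ⊢
    rw [ht, map_add]
    abel

theorem posOp_smul (c : ℂ) (a : T.pos) : posOp T M (c • a) = c • posOp T M a := by
  refine LinearMap.ext fun t => ?_
  induction t using wedge_induction with
  | one m => rw [LinearMap.smul_apply, posOp_one, posOp_one, smul_zero]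
  | add s t hs ht => rw [map_add, map_add, hs, ht]
  | wedge y t ht =>
    have : T.posNeg (c • a) y = c • T.posNeg a y := Subtype.ext (by simp)
    simp only [LinearMap.smul_apply, posOp_wedge, this, evenOp_smul] at ht ⊢
    rw [ht, map_smul, smul_sub]

/-- The action of `g_1` on `Λ(g_{-1}) ⊗ M`, as a linear map. -/
def posOpHom : T.pos →ₗ[ℂ] ExtMod T.neg M →ₗ[ℂ] ExtMod T.neg M where
  toFun := posOp T M
  map_add' := posOp_add T M
  map_smul' := posOp_smul T M

theorem posOp_zero : posOp T M 0 = 0 := map_zero (posOpHom T M)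

theorem evenOp_evenOp (a b : EvenPart g) (t : ExtMod T.neg M) :
    evenOp T M a (evenOp T M b t) = evenOp T M b (evenOp T M a t) + evenOp T M ⁅a, b⁆ t := by
  induction t using wedge_induction with
  | one m =>
    rw [evenOp_one, evenOp_one, evenOp_one, evenOp_one, evenOp_one, ← map_add, leibniz_lie, add_comm]
  | add s t hs ht => simp only [map_add, hs, ht]; abel
  | wedge y t ht =>
    have : T.evenNeg a (T.evenNeg b y) = T.evenNeg b (T.evenNeg a y) + T.evenNeg ⁅a, b⁆ y :=
      Subtype.ext (by simp [coe_bracket, jacobi_even a b.1 y.1, add_comm])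
    simp only [evenOp_wedge, map_add, ht, this, LinearMap.add_apply]
    abel

/-- The action of an even element on `g_1`. -/
def TypeI.evenPos (a : EvenPart g) (x : T.pos) : T.pos := ⟨br a.1 x.1, T.even_pos a x.1 x.2⟩

theorem evenOp_posOp (a : EvenPart g) (x : T.pos) (t : ExtMod T.neg M) :
    evenOp T M a (posOp T M x t) =
      posOp T M x (evenOp T M a t) + posOp T M (T.evenPos a x) t := by
  induction t using wedge_induction with
  | one m => simp only [evenOp_one, posOp_one, map_zero, add_zero]
  | add s t hs ht => simp only [map_add, hs, ht]; abel
  | wedge y t ht =>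
    have : ⁅a, T.posNeg x y⁆ = T.posNeg (T.evenPos a x) y + T.posNeg x (T.evenNeg a y) :=
      Subtype.ext (by simp [coe_bracket, jacobi_even a x.1 y.1, TypeI.evenPos])
    simp only [evenOp_wedge, posOp_wedge, map_add, map_sub, ht, LinearMap.add_apply,
      evenOp_evenOp T M a, this, evenOp_add]
    abel

/-- Moving `x` twice past `y` leaves, besides `y ∧ xxt`, only the commutator of `x` with `[x,y]`,
which is zero. Polarization then gives anticommutation of all of `g_1`. -/
theorem posOp_posOp_self (x : T.pos) (t : ExtMod T.neg M) :
    posOp T M x (posOp T M x t) = 0 := by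
  induction t using wedge_induction with
  | one m => simp only [posOp_one, map_zero]
  | add s t hs ht => simp only [map_add, hs, ht, add_zero]
  | wedge y t ht =>
    have : T.evenPos (T.posNeg x y) x = 0 := Subtype.ext (br_br_pos_self T x y)
    simp only [posOp_wedge, map_sub, ht, evenOp_posOp, this, posOp_zero, LinearMap.zero_apply]
    abel

theorem posOp_posOp (x x' : T.pos) (t : ExtMod T.neg M) :
    posOp T M x (posOp T M x' t) = -posOp T M x' (posOp T M x t) := by
  have h := posOp_posOp_self T M (x + x') t
  simp only [posOp_add, map_add, LinearMap.add_apply, posOp_posOp_self, zero_add, add_zero] at h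
  exact eq_neg_of_add_eq_zero_right h

/-- The action of `g` on `Λ(g_{-1}) ⊗ M`. -/
def extOp : g →ₗ[ℂ] ExtMod T.neg M →ₗ[ℂ] ExtMod T.neg M :=
  evenOpHom T M ∘ₗ (part (g := g) 0).projectionOnto (part 1) isCompl +
  wedge T.neg M ∘ₗ T.neg.projectionOnto _ T.isCompl_neg +
  posOpHom T M ∘ₗ T.pos.projectionOnto _ T.isCompl_pos

theorem extOp_even (a : EvenPart g) : extOp T M a.1 = evenOp T M a := by
  simp only [extOp, LinearMap.add_apply, LinearMap.comp_apply]
  rw [Submodule.projectionOnto_apply_of_mem_left _ a.2,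
    Submodule.projectionOnto_apply_of_mem_right _ (Submodule.mem_sup_left a.2),
    Submodule.projectionOnto_apply_of_mem_right _ (Submodule.mem_sup_left a.2), map_zero, map_zero,
    add_zero, add_zero]
  rfl

theorem extOp_neg (y : T.neg) : extOp T M y.1 = wedge T.neg M y := by
  simp only [extOp, LinearMap.add_apply, LinearMap.comp_apply]
  rw [Submodule.projectionOnto_apply_of_mem_right _ (T.neg_le y.2),
    Submodule.projectionOnto_apply_of_mem_left _ y.2,
    Submodule.projectionOnto_apply_of_mem_right _ (Submodule.mem_sup_right y.2), map_zero, map_zero,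
    add_zero, zero_add]

theorem extOp_pos (x : T.pos) : extOp T M x.1 = posOp T M x := by
  simp only [extOp, LinearMap.add_apply, LinearMap.comp_apply]
  rw [Submodule.projectionOnto_apply_of_mem_right _ (T.pos_le x.2),
    Submodule.projectionOnto_apply_of_mem_right _ (Submodule.mem_sup_right x.2),
    Submodule.projectionOnto_apply_of_mem_left _ x.2, map_zero, map_zero, add_zero, zero_add]
  rfl

theorem extOp_even_odd (a : EvenPart g) (z : g) (hz : z ∈ part (g := g) 1) (t : ExtMod T.neg M) :
    extOp T M a.1 (extOp T M z t) = extOp T M z (extOp T M a.1 t) + extOp T M (br a.1 z) t := by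
  rw [← T.sup_eq] at hz
  obtain ⟨y, hy, x, hx, rfl⟩ := Submodule.mem_sup.mp hz
  have h1 : br a.1 y = (T.evenNeg a ⟨y, hy⟩).1 := rfl
  have h2 : br a.1 x = (T.evenPos a ⟨x, hx⟩).1 := rfl
  rw [map_add, map_add, map_add, h1, h2, extOp_even, extOp_neg T M ⟨y, hy⟩, extOp_neg,
    extOp_pos T M ⟨x, hx⟩, extOp_pos]
  simp only [LinearMap.add_apply, map_add, evenOp_wedge, evenOp_posOp]
  abel

theorem extOp_odd_odd (z z' : g) (hz : z ∈ part (g := g) 1) (hz' : z' ∈ part (g := g) 1)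
    (t : ExtMod T.neg M) :
    extOp T M z (extOp T M z' t) = -extOp T M z' (extOp T M z t) + extOp T M (br z z') t := by
  rw [← T.sup_eq] at hz hz'
  obtain ⟨y, hy, x, hx, rfl⟩ := Submodule.mem_sup.mp hz
  obtain ⟨y', hy', x', hx', rfl⟩ := Submodule.mem_sup.mp hz'
  have h1 : br x y' = (T.posNeg ⟨x, hx⟩ ⟨y', hy'⟩).1 := rfl
  have h2 : br y x' = (T.posNeg ⟨x', hx'⟩ ⟨y, hy⟩).1 := by
    rw [skew 1 1 y x' (T.neg_le hy) (T.pos_le hx'), sgn_one_one, neg_smul, one_smul, neg_neg]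
    rfl
  simp only [map_add, LinearMap.add_apply]
  rw [T.neg_neg y hy y' hy', T.pos_pos x hx x' hx', h1, h2, extOp_even, extOp_even,
    extOp_neg T M ⟨y, hy⟩, extOp_neg T M ⟨y', hy'⟩, extOp_pos T M ⟨x, hx⟩, extOp_pos T M ⟨x', hx'⟩]
  simp only [map_zero, LinearMap.zero_apply, posOp_wedge]
  rw [wedge_wedge_swap, posOp_posOp]
  abel

/-- These are the defining relations of `U(g)`, so the operators assemble into a module structure.
The odd-even case follows from the even-odd one by skew symmetry. -/
theorem extOp_extOp (i j : ZMod 2) (x y : g) (hx : x ∈ part i) (hy : y ∈ part j)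
    (t : ExtMod T.neg M) : extOp T M x (extOp T M y t) =
      sgn i j • extOp T M y (extOp T M x t) + extOp T M (br x y) t := by
  rcases zmod_two i with rfl | rfl <;> rcases zmod_two j with rfl | rfl
  · rw [sgn_zero_left, one_smul]
    have h : br x y = (⁅(⟨x, hx⟩ : EvenPart g), (⟨y, hy⟩ : EvenPart g)⁆ : EvenPart g).1 := rfl
    rw [h, extOp_even T M ⟨x, hx⟩, extOp_even T M ⟨y, hy⟩, extOp_even]
    exact evenOp_evenOp T M _ _ t
  · rw [sgn_zero_left, one_smul]
    exact extOp_even_odd T M ⟨x, hx⟩ y hy t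
  · have h := extOp_even_odd T M ⟨y, hy⟩ x hx t
    rw [sgn_zero_right, one_smul, skew 1 0 x y hx hy, sgn_zero_right, one_smul, map_neg,
      LinearMap.neg_apply, h, add_neg_cancel_right]
  · rw [sgn_one_one, neg_smul, one_smul]
    exact extOp_odd_odd T M x y hx hy t

/-- The action of `U(g)` on `Λ(g_{-1}) ⊗ M`. -/
def extRep : U g →ₐ[ℂ] Module.End ℂ (ExtMod T.neg M) :=
  liftU (A := Module.End ℂ (ExtMod T.neg M)) (extOp T M) fun i j x y hx hy =>
    LinearMap.ext (extOp_extOp T M i j x y hx hy)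

instance : Module (U g) (ExtMod T.neg M) := Module.compHom _ (extRep T M).toRingHom

theorem ExtMod.smul_def (u : U g) (t : ExtMod T.neg M) : u • t = extRep T M u t := rfl

theorem ExtMod.ι_smul (x : g) (t : ExtMod T.neg M) : (ι x : U g) • t = extOp T M x t := by
  rw [ExtMod.smul_def, extRep, liftU_ι]

instance : IsScalarTower ℂ (U g) (ExtMod T.neg M) where
  smul_assoc c u t := by rw [ExtMod.smul_def, map_smul]; rfl

theorem ExtMod.ι_smul_even (a : EvenPart g) (t : ExtMod T.neg M) :
    (ι a.1 : U g) • t = evenOp T M a t := by rw [ExtMod.ι_smul, extOp_even]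

theorem ExtMod.ι_smul_neg (y : T.neg) (t : ExtMod T.neg M) :
    (ι y.1 : U g) • t = wedge T.neg M y t := by rw [ExtMod.ι_smul, extOp_neg]

theorem ExtMod.ι_smul_pos (x : T.pos) (t : ExtMod T.neg M) :
    (ι x.1 : U g) • t = posOp T M x t := by rw [ExtMod.ι_smul, extOp_pos]

end rep

/-! ### Kac modules: generators and the universal property -/

section kac

open LieSuperalgebra ExtMod

variable {g : Type*} [AddCommGroup g] [Module ℂ g] [LieSuperalgebra g] (T : TypeI g)
variable (M : Type*) [AddCommGroup M] [Module ℂ M] [LieRingModule (EvenPart g) M]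
  [LieModule ℂ (EvenPart g) M]
variable {M' : Type*} [AddCommGroup M'] [Module ℂ M'] [LieRingModule (EvenPart g) M']
  [LieModule ℂ (EvenPart g) M']
variable {M'' : Type*} [AddCommGroup M''] [Module ℂ M''] [LieRingModule (EvenPart g) M'']
  [LieModule ℂ (EvenPart g) M'']

namespace Kac

theorem ι_even_smul_mk (a : EvenPart g) (m : M) : (ι a.1 : U g) • mk T M m = mk T M ⁅a, m⁆ := by
  have h : (ι a.1 ⊗ₜ[ℂ] m - 1 ⊗ₜ[ℂ] ⁅a, m⁆ : U g ⊗[ℂ] M) ∈ kacRel T M :=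
    Submodule.subset_span (Or.inl ⟨a, m, rfl⟩)
  have h2 : (kacRel T M).mkQ (ι a.1 ⊗ₜ[ℂ] m) = (kacRel T M).mkQ (1 ⊗ₜ[ℂ] ⁅a, m⁆) :=
    (Submodule.Quotient.eq _).mpr h
  have h3 : (ι a.1 : U g) • mk T M m = (kacRel T M).mkQ ((ι a.1 : U g) • (1 ⊗ₜ[ℂ] m)) := rfl
  rw [h3, TensorProduct.smul_tmul', smul_eq_mul, mul_one, h2]
  rfl

theorem ι_pos_smul_mk (x : g) (hx : x ∈ T.pos) (m : M) : (ι x : U g) • mk T M m = 0 := by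
  have h : (ι x ⊗ₜ[ℂ] m : U g ⊗[ℂ] M) ∈ kacRel T M := Submodule.subset_span (Or.inr ⟨x, hx, m, rfl⟩)
  have h3 : (ι x : U g) • mk T M m = (kacRel T M).mkQ ((ι x : U g) • (1 ⊗ₜ[ℂ] m)) := rfl
  rw [h3, TensorProduct.smul_tmul', smul_eq_mul, mul_one]
  exact (Submodule.Quotient.mk_eq_zero _).mpr h

variable {T M}

theorem induction_mk {P : Kac T M → Prop} (k : Kac T M) (smul : ∀ (u : U g) m, P (u • mk T M m))
    (add : ∀ s t, P s → P t → P (s + t)) : P k := by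
  obtain ⟨t, rfl⟩ := (kacRel T M).mkQ_surjective k
  induction t with
  | zero => have h := smul 0 0; rw [zero_smul] at h; exact h
  | add s t hs ht => exact add _ _ hs ht
  | tmul u m =>
    have h : (kacRel T M).mkQ (u ⊗ₜ[ℂ] m) = (kacRel T M).mkQ (u • (1 ⊗ₜ[ℂ] m)) := by
      rw [TensorProduct.smul_tmul', smul_eq_mul, mul_one]
    rw [h]
    exact smul u m

theorem parity_mk (m : M) :
    SuperModule.parity (g := g) (mk T M m) = mk T M m := by
  change (kacRel T M).mkQ (tensorParity M (1 ⊗ₜ[ℂ] m)) = (kacRel T M).mkQ (1 ⊗ₜ[ℂ] m)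
  rw [tensorParity_tmul, map_one]

theorem parity_smul_mk (u : U g) (m : M) :
    SuperModule.parity (g := g) (u • mk T M m) = parU u • mk T M m := by
  rw [LinearMap.map_smulₛₗ, parity_mk]
  rfl

variable {N : Type*} [AddCommGroup N] [Module ℂ N] [Module (U g) N] [IsScalarTower ℂ (U g) N]

theorem hom_ext {f f' : Kac T M →ₗ[U g] N} (h : ∀ m, f (mk T M m) = f' (mk T M m)) : f = f' := by
  refine LinearMap.ext fun k => ?_
  induction k using induction_mk with
  | smul u m => rw [map_smul, map_smul, h]
  | add s t hs ht => rw [map_add, map_add, hs, ht]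

/-- The universal property of the Kac module. -/
def lift (f : M →ₗ[ℂ] N) (h0 : ∀ (a : EvenPart g) m, f ⁅a, m⁆ = (ι a.1 : U g) • f m)
    (h1 : ∀ x ∈ T.pos, ∀ m, (ι x : U g) • f m = 0) : Kac T M →ₗ[U g] N :=
  (kacRel T M).liftQ (TensorProduct.AlgebraTensorModule.lift
      (LinearMap.toSpanSingleton (U g) (M →ₗ[ℂ] N) f)) (by
    refine Submodule.span_le.mpr ?_
    rintro _ (⟨a, m, rfl⟩ | ⟨x, hx, m, rfl⟩)
    · simp [h0]
    · simp [h1 x hx])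

theorem lift_mk (f : M →ₗ[ℂ] N) (h0 : ∀ (a : EvenPart g) m, f ⁅a, m⁆ = (ι a.1 : U g) • f m)
    (h1 : ∀ x ∈ T.pos, ∀ m, (ι x : U g) • f m = 0) (m : M) : lift f h0 h1 (mk T M m) = f m := by
  change (TensorProduct.AlgebraTensorModule.lift
      (LinearMap.toSpanSingleton (U g) (M →ₗ[ℂ] N) f)) (1 ⊗ₜ[ℂ] m) = f m
  simp

variable (T) in
/-- The functoriality of the Kac module. -/
def map (f : M →ₗ⁅ℂ, EvenPart g⁆ M') : Kac T M →ₗ[U g] Kac T M' :=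
  lift (mk T M' ∘ₗ (f : M →ₗ[ℂ] M'))
    (fun a m => by
      change mk T M' (f ⁅a, m⁆) = (ι a.1 : U g) • mk T M' (f m)
      rw [ι_even_smul_mk, LieModuleHom.map_lie])
    (fun x hx m => ι_pos_smul_mk T M' x hx (f m))

theorem map_mk (f : M →ₗ⁅ℂ, EvenPart g⁆ M') (m : M) : map T f (mk T M m) = mk T M' (f m) :=
  lift_mk _ _ _ m

theorem map_comp (f' : M' →ₗ⁅ℂ, EvenPart g⁆ M'') (f : M →ₗ⁅ℂ, EvenPart g⁆ M') :
    map T (f'.comp f) = map T f' ∘ₗ map T f :=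
  hom_ext (N := Kac T M'') fun m => by
    rw [LinearMap.comp_apply, map_mk, map_mk, map_mk, LieModuleHom.comp_apply]

theorem isEvenMap_map (f : M →ₗ⁅ℂ, EvenPart g⁆ M') : IsEvenMap (map T f) := by
  intro k
  induction k using induction_mk with
  | smul u m => rw [parity_smul_mk, map_smul, map_smul, map_mk, parity_smul_mk]
  | add s t hs ht => simp only [map_add, hs, ht]

/-! ### The isomorphism `K(M) ≃ Λ(g_{-1}) ⊗ M` and exactness of the Kac functor -/

variable (T) in
/-- The algebra map `Λ(g_{-1}) → U(g)`. -/
def extU : ExteriorAlgebra ℂ T.neg →ₐ[ℂ] U g :=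
  ExteriorAlgebra.lift ℂ ⟨ι ∘ₗ T.neg.subtype, fun y => by
    have h := ι_mul 1 1 y.1 y.1 (T.neg_le y.2) (T.neg_le y.2)
    rw [T.neg_neg _ y.2 _ y.2, map_zero, add_zero, sgn_one_one, neg_smul, one_smul,
      eq_neg_iff_add_eq_zero, ← two_smul ℂ] at h
    exact (smul_eq_zero.mp h).resolve_left two_ne_zero⟩

theorem extU_ι (y : T.neg) : extU T (ExteriorAlgebra.ι ℂ y) = ι y.1 :=
  ExteriorAlgebra.lift_ι_apply ℂ (ι ∘ₗ T.neg.subtype : T.neg →ₗ[ℂ] U g) _ y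

variable (T M) in
/-- The map `Λ(g_{-1}) ⊗ M → K(M)`, `w ⊗ m ↦ w (1 ⊗ m)`. -/
def ofExt : ExtMod T.neg M →ₗ[ℂ] Kac T M :=
  TensorProduct.lift (LinearMap.mk₂ ℂ (fun w m => extU T w • mk T M m)
    (fun w w' m => by rw [map_add, add_smul])
    (fun c w m => by rw [map_smul, smul_assoc])
    (fun w m m' => by rw [map_add, smul_add])
    (fun c w m => by rw [map_smul, smul_comm]))

theorem ofExt_tmul (w : ExteriorAlgebra ℂ T.neg) (m : M) :
    ofExt T M (tmul T.neg M w m) = extU T w • mk T M m := rfl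

theorem ofExt_one (m : M) : ofExt T M (one T.neg m) = mk T M m := by
  rw [one, ofExt_tmul, map_one, one_smul]

theorem ofExt_wedge (y : T.neg) (t : ExtMod T.neg M) :
    ofExt T M (wedge T.neg M y t) = (ι y.1 : U g) • ofExt T M t := by
  induction t using induction_tmul with
  | tmul w m => rw [wedge_tmul, ofExt_tmul, ofExt_tmul, map_mul, extU_ι, mul_smul]
  | add s t hs ht => rw [map_add, map_add, map_add, smul_add, hs, ht]

theorem ofExt_even (a : EvenPart g) (t : ExtMod T.neg M) :
    ofExt T M (evenOp T M a t) = (ι a.1 : U g) • ofExt T M t := by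
  induction t using wedge_induction with
  | one m => rw [evenOp_one, ofExt_one, ofExt_one, ι_even_smul_mk]
  | add s t hs ht => rw [map_add, map_add, map_add, smul_add, hs, ht]
  | wedge y t ht =>
    rw [evenOp_wedge, map_add, ofExt_wedge, ofExt_wedge, ofExt_wedge, ht, smul_smul, smul_smul,
      ι_mul 0 1 a.1 y.1 a.2 (T.neg_le y.2), sgn_zero_left, one_smul, add_smul, add_comm]
    rfl

theorem ofExt_pos (x : T.pos) (t : ExtMod T.neg M) :
    ofExt T M (posOp T M x t) = (ι x.1 : U g) • ofExt T M t := by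
  induction t using wedge_induction with
  | one m => rw [posOp_one, ofExt_one, ι_pos_smul_mk T M x.1 x.2, map_zero]
  | add s t hs ht => rw [map_add, map_add, map_add, smul_add, hs, ht]
  | wedge y t ht =>
    rw [posOp_wedge, map_sub, ofExt_wedge, ofExt_wedge, ht, smul_smul, smul_smul, ofExt_even,
      ι_mul 1 1 x.1 y.1 (T.pos_le x.2) (T.neg_le y.2), sgn_one_one, neg_smul, one_smul, add_smul,
      neg_smul, sub_eq_add_neg, add_comm]
    rfl

theorem exists_decomp (x : g) :
    ∃ (a : EvenPart g) (y : T.neg) (z : T.pos), x = a.1 + (y.1 + z.1) := by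
  obtain ⟨a, ha, w, hw, rfl⟩ := Submodule.mem_sup.mp
    (show x ∈ part (g := g) 0 ⊔ part 1 by rw [isCompl.sup_eq_top]; trivial)
  rw [← T.sup_eq] at hw
  obtain ⟨y, hy, z, hz, rfl⟩ := Submodule.mem_sup.mp hw
  exact ⟨⟨a, ha⟩, ⟨y, hy⟩, ⟨z, hz⟩, rfl⟩

variable (T M) in
/-- The map `Λ(g_{-1}) ⊗ M → K(M)` is `U(g)`-linear. -/
def ofExtU : ExtMod T.neg M →ₗ[U g] Kac T M :=
  linearOfComm (ofExt T M) fun x t => by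
    obtain ⟨a, y, z, rfl⟩ := exists_decomp (T := T) x
    simp only [map_add, add_smul, ι_smul_even, ι_smul_neg, ι_smul_pos, ofExt_even, ofExt_wedge,
      ofExt_pos]

theorem ofExtU_apply (t : ExtMod T.neg M) : ofExtU T M t = ofExt T M t := rfl

variable (T M) in
/-- The map `K(M) → Λ(g_{-1}) ⊗ M`. -/
def toExtU : Kac T M →ₗ[U g] ExtMod T.neg M :=
  lift (one T.neg) (fun a m => by rw [ι_smul_even, evenOp_one])
    (fun x hx m => by rw [ι_smul_pos T M ⟨x, hx⟩, posOp_one])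

theorem toExtU_mk (m : M) : toExtU T M (mk T M m) = one T.neg m := lift_mk _ _ _ m

variable (T M) in
/-- The isomorphism of `U(g)`-modules `K(M) ≃ Λ(g_{-1}) ⊗ M`. -/
def equivExt : Kac T M ≃ₗ[U g] ExtMod T.neg M :=
  LinearEquiv.ofLinearMap (toExtU T M) (ofExtU T M)
    (LinearMap.ext fun t => by
      rw [LinearMap.comp_apply, LinearMap.id_apply]
      induction t using wedge_induction with
      | one m => rw [ofExtU_apply, ofExt_one, toExtU_mk]
      | add s t hs ht => rw [map_add, map_add, hs, ht]
      | wedge y t ht => rw [← ι_smul_neg, map_smul, map_smul, ht])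
    (hom_ext (N := Kac T M) fun m => by
      rw [LinearMap.comp_apply, LinearMap.id_apply, toExtU_mk, ofExtU_apply, ofExt_one])

theorem equivExt_mk (m : M) : equivExt T M (mk T M m) = one T.neg m := toExtU_mk m

theorem equivExt_symm (t : ExtMod T.neg M) : (equivExt T M).symm t = ofExt T M t := rfl

/-- By the isomorphism with `Λ(g_{-1}) ⊗ M`, the elements of `g_{-1}` alone generate `K(M)` from `1
⊗ M`. -/
theorem induction_neg {P : Kac T M → Prop} (k : Kac T M) (mk : ∀ m, P (mk T M m))
    (add : ∀ s t, P s → P t → P (s + t)) (smul : ∀ (y : T.neg) t, P t → P ((ι y.1 : U g) • t)) :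
    P k := by
  obtain ⟨t, rfl⟩ := (equivExt T M).symm.surjective k
  induction t using wedge_induction with
  | one m => rw [equivExt_symm, ofExt_one]; exact mk m
  | add s t hs ht => rw [map_add]; exact add _ _ hs ht
  | wedge y t ht => rw [equivExt_symm, ofExt_wedge]; exact smul y _ ht

/-- Naturality in `M` of the identification with `Λ(g_{-1}) ⊗ M`; it reduces exactness and
injectivity to flatness of a vector space. -/
theorem map_ofExt (f : M →ₗ⁅ℂ, EvenPart g⁆ M') (t : ExtMod T.neg M) :
    map T f (ofExt T M t) = ofExt T M' (LinearMap.lTensor (ExteriorAlgebra ℂ T.neg)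
      (f : M →ₗ[ℂ] M') t) := by
  induction t using induction_tmul with
  | tmul w m =>
    rw [ofExt_tmul, map_smul, map_mk]
    rfl
  | add s t hs ht =>
    rw [map_add, map_add, hs, ht]
    exact ((congrArg _ (map_add (LinearMap.lTensor (ExteriorAlgebra ℂ T.neg)
      (f : M →ₗ[ℂ] M')) s t)).trans (map_add (ofExt T M') _ _)).symm

/-- The Kac functor is exact. -/
theorem exact_map (f : M →ₗ⁅ℂ, EvenPart g⁆ M') (f' : M' →ₗ⁅ℂ, EvenPart g⁆ M'')
    (h : Function.Exact f f') : Function.Exact (map T f) (map T f') := by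
  have hex : Function.Exact (LinearMap.lTensor (ExteriorAlgebra ℂ T.neg) (f : M →ₗ[ℂ] M'))
      (LinearMap.lTensor (ExteriorAlgebra ℂ T.neg) (f' : M' →ₗ[ℂ] M'')) :=
    Module.Flat.lTensor_exact _ h
  intro k
  obtain ⟨t, rfl⟩ := (equivExt T M').symm.surjective k
  rw [equivExt_symm, map_ofExt]
  constructor
  · intro h0
    have h1 := (equivExt T M'').symm.injective (h0.trans (map_zero _).symm)
    obtain ⟨s, hs⟩ := (hex t).mp h1
    exact ⟨ofExt T M s, (map_ofExt f s).trans (congrArg _ hs)⟩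
  · rintro ⟨k', hk'⟩
    obtain ⟨s, rfl⟩ := (equivExt T M).symm.surjective k'
    rw [equivExt_symm, map_ofExt] at hk'
    have h1 := (equivExt T M').symm.injective hk'
    exact (congrArg _ ((hex t).mpr ⟨s, h1⟩)).trans (map_zero (ofExt T M''))

theorem map_injective (f : M →ₗ⁅ℂ, EvenPart g⁆ M') (h : Function.Injective f) :
    Function.Injective (map T f) := by
  have hinj : Function.Injective (LinearMap.lTensor (ExteriorAlgebra ℂ T.neg)
      (f : M →ₗ[ℂ] M')) := Module.Flat.lTensor_preserves_injective_linearMap _ h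
  intro k k' hk
  obtain ⟨t, rfl⟩ := (equivExt T M).symm.surjective k
  obtain ⟨t', rfl⟩ := (equivExt T M).symm.surjective k'
  rw [equivExt_symm, equivExt_symm, map_ofExt, map_ofExt] at hk
  exact congrArg _ (hinj ((equivExt T M').symm.injective hk))

theorem map_surjective (f : M →ₗ⁅ℂ, EvenPart g⁆ M') (h : Function.Surjective f) :
    Function.Surjective (map T f) := by
  intro k
  induction k using induction_mk with
  | smul u m =>
    obtain ⟨m, rfl⟩ := h m
    exact ⟨u • mk T M m, by rw [map_smul, map_mk]⟩
  | add s t hs ht =>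
    obtain ⟨a, rfl⟩ := hs
    obtain ⟨b, rfl⟩ := ht
    exact ⟨a + b, map_add _ _ _⟩

/-! ### The projection of `K(M)` onto `M` and the nilpotent action of `g_{-1}` -/

variable (T M) in
/-- The projection `Λ(g_{-1}) ⊗ M → M`. -/
def extProj : ExtMod T.neg M →ₗ[ℂ] M :=
  TensorProduct.lid ℂ M ∘ₗ
    LinearMap.rTensor M (ExteriorAlgebra.algebraMapInv (R := ℂ) (M := T.neg)).toLinearMap

theorem extProj_tmul (w : ExteriorAlgebra ℂ T.neg) (m : M) :
    extProj T M (tmul T.neg M w m) = ExteriorAlgebra.algebraMapInv w • m := rfl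

variable (T M) in
/-- The projection `K(M) → M` that kills `g_{-1} K(M)`. -/
def proj : Kac T M →ₗ[ℂ] M := extProj T M ∘ₗ (equivExt T M).toLinearMap.restrictScalars ℂ

theorem proj_mk (m : M) : proj T M (mk T M m) = m := by
  change extProj T M (equivExt T M (mk T M m)) = m
  rw [equivExt_mk, one, extProj_tmul, map_one, one_smul]

theorem proj_neg_smul (y : T.neg) (k : Kac T M) : proj T M ((ι y.1 : U g) • k) = 0 := by
  change extProj T M (equivExt T M ((ι y.1 : U g) • k)) = 0
  rw [map_smul, ι_smul_neg]
  generalize equivExt T M k = t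
  induction t using induction_tmul with
  | tmul w m =>
    rw [wedge_tmul, extProj_tmul, map_mul, ExteriorAlgebra.algebraMapInv,
      ExteriorAlgebra.lift_ι_apply, LinearMap.zero_apply, zero_mul, zero_smul]
  | add s t hs ht => rw [map_add, map_add, hs, ht, add_zero]

/-- `g_0` preserves `g_{-1}K(M)` because `ay = ya + [a,y]` with `[a,y]` in `g_{-1}`. The projection
need not commute with `g_1`, so only `g_0`-submodules of `M` arise as images below. -/
theorem proj_even_smul (a : EvenPart g) (k : Kac T M) :
    proj T M ((ι a.1 : U g) • k) = ⁅a, proj T M k⁆ := by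
  induction k using induction_neg with
  | mk m => rw [ι_even_smul_mk, proj_mk, proj_mk]
  | add s t hs ht => rw [smul_add, map_add, map_add, lie_add, hs, ht]
  | smul y t ht =>
    rw [proj_neg_smul, lie_zero, smul_smul, ι_mul 0 1 a.1 y.1 a.2 (T.neg_le y.2), sgn_zero_left,
      one_smul, add_smul, mul_smul, map_add, proj_neg_smul, zero_add]
    exact proj_neg_smul (T.evenNeg a y) t

theorem mk_injective : Function.Injective (mk T M) :=
  Function.LeftInverse.injective (g := proj T M) proj_mk

variable (T M) in
/-- The action of `g_{-1}` on `K(M)`. -/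
def negOp (y : T.neg) : Kac T M →ₗ[ℂ] Kac T M := Module.toModuleEnd ℂ (S := U g) (Kac T M) (ι y.1)

theorem negOp_apply (y : T.neg) (k : Kac T M) : negOp T M y k = (ι y.1 : U g) • k := rfl

theorem sub_mk_proj_mem (k : Kac T M) :
    k - mk T M (proj T M k) ∈ ⨆ y, LinearMap.range (negOp T M y) := by
  induction k using induction_neg with
  | mk m => rw [proj_mk, sub_self]; exact zero_mem _
  | add s t hs ht =>
    rw [map_add, map_add, add_sub_add_comm]
    exact add_mem hs ht
  | smul y t ht =>
    rw [proj_neg_smul, map_zero, sub_zero]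
    exact Submodule.mem_iSup_of_mem y ⟨t, rfl⟩

/-- Every `k` differs from `1 ⊗ proj k` by an element of `g_{-1}K(M)`. -/
theorem ker_proj_le : LinearMap.ker (proj T M) ≤ ⨆ y, LinearMap.range (negOp T M y) := by
  intro k hk
  have h := sub_mk_proj_mem k
  rwa [LinearMap.mem_ker.mp hk, map_zero, sub_zero] at h

theorem foldr_negOp_eq_zero [FiniteDimensional ℂ g] (l : List T.neg)
    (hl : Module.finrank ℂ T.neg < l.length) (k : Kac T M) :
    l.foldr (fun y s => negOp T M y s) k = 0 := by
  have h : ∀ (l : List T.neg) (k : Kac T M), equivExt T M (l.foldr (fun y s => negOp T M y s) k) =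
      l.foldr (fun y s => wedge T.neg M y s) (equivExt T M k) := by
    intro l k
    induction l with
    | nil => rfl
    | cons y l ih =>
      rw [List.foldr_cons, List.foldr_cons, ← ih, negOp_apply, map_smul, ι_smul_neg]
  exact (equivExt T M).injective ((h l k).trans
    ((foldr_wedge_eq_zero l hl _).trans (map_zero _).symm))

theorem finiteDimensional [FiniteDimensional ℂ g] [FiniteDimensional ℂ M] :
    FiniteDimensional ℂ (Kac T M) :=
  Module.Finite.equiv ((equivExt T M).restrictScalars ℂ).symm

end Kac
end kac

/-! ### Direct sum decompositions stable under nilpotent operators -/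

section nilpotent

variable {X M I : Type*} [AddCommGroup X] [Module ℂ X] [AddCommGroup M] [Module ℂ M]

/-- An element of the kernel lies in `∑ Y_i S + ∑ Y_i T`. If it is also in `S`, its part in `T` is
zero, since the sum of `S` and `T` is direct. -/
theorem inf_ker_le_iSup_map (π : X →ₗ[ℂ] M) (Y : I → X →ₗ[ℂ] X)
    (hker : LinearMap.ker π ≤ ⨆ i, LinearMap.range (Y i)) {S T : Submodule ℂ X} (hST : IsCompl S T)
    (hS : ∀ i, ∀ x ∈ S, Y i x ∈ S) (hT : ∀ i, ∀ x ∈ T, Y i x ∈ T) :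
    S ⊓ LinearMap.ker π ≤ ⨆ i, S.map (Y i) := by
  have h1 : ⨆ i, LinearMap.range (Y i) ≤ (⨆ i, S.map (Y i)) ⊔ ⨆ i, T.map (Y i) := by
    refine iSup_le fun i => ?_
    rw [LinearMap.range_eq_map, ← hST.sup_eq_top, Submodule.map_sup]
    exact sup_le_sup (le_iSup (fun i => S.map (Y i)) i) (le_iSup (fun i => T.map (Y i)) i)
  have hS1 : ⨆ i, S.map (Y i) ≤ S := iSup_le fun i => Submodule.map_le_iff_le_comap.mpr (hS i)
  have hT1 : ⨆ i, T.map (Y i) ≤ T := iSup_le fun i => Submodule.map_le_iff_le_comap.mpr (hT i)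
  rintro x ⟨hx, hx'⟩
  obtain ⟨a, ha, b, hb, rfl⟩ := Submodule.mem_sup.mp (h1 (hker hx'))
  have hbS : b ∈ S := by
    have := sub_mem hx (hS1 ha)
    rwa [add_sub_cancel_left] at this
  have hb0 : b = 0 := by simpa using hST.inf_eq_bot.le ⟨hbS, hT1 hb⟩
  rw [hb0, add_zero]
  exact ha

/-- A nilpotent form of Nakayama's lemma: iterating the inclusion writes `S` inside the span of the
words of length `N` applied to `S`. -/
theorem eq_bot_of_le_iSup_map (Y : I → X →ₗ[ℂ] X) (N : ℕ)
    (hnil : ∀ l : List I, l.length = N → ∀ x, l.foldr (fun i x => Y i x) x = 0)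
    {S : Submodule ℂ X} (hS : S ≤ ⨆ i, S.map (Y i)) : S = ⊥ := by
  have hadd : ∀ (l : List I) (x y : X), l.foldr (fun i x => Y i x) (x + y) =
      l.foldr (fun i x => Y i x) x + l.foldr (fun i x => Y i x) y := by
    intro l x y
    induction l with
    | nil => rfl
    | cons i l ih => simp only [List.foldr_cons, ih, map_add]
  have hsmul : ∀ (l : List I) (c : ℂ) (x : X), l.foldr (fun i x => Y i x) (c • x) =
      c • l.foldr (fun i x => Y i x) x := by
    intro l c x
    induction l with
    | nil => rfl
    | cons i l ih => simp only [List.foldr_cons, ih, map_smul]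
  -- If all words of length `m + 1` kill `S`, so do those of length `m`, because `S` is contained in
  -- `∑ Y_i S`. Descending to length `0` shows that the empty word, the identity, kills `S`.
  have key : ∀ j ≤ N, ∀ l : List I, l.length = N - j → ∀ x ∈ S,
      l.foldr (fun i x => Y i x) x = 0 := by
    intro j
    induction j with
    | zero => intro _ l hl x _; exact hnil l hl x
    | succ j ih =>
      intro hj l hl x hx
      let f : X →ₗ[ℂ] X := ⟨⟨fun x => l.foldr (fun i x => Y i x) x, hadd l⟩, hsmul l⟩
      have hf : ⨆ i, S.map (Y i) ≤ LinearMap.ker f := by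
        refine iSup_le fun i => ?_
        rintro _ ⟨y, hy, rfl⟩
        have := ih (by omega) (l ++ [i]) (by rw [List.length_append, hl, List.length_singleton]; omega)
          y hy
        rwa [List.foldr_append] at this
      exact hf (hS hx)
  refine (Submodule.eq_bot_iff _).mpr fun x hx => ?_
  exact key N le_rfl [] (by simp) x hx

theorem eq_bot_of_map_eq_bot (π : X →ₗ[ℂ] M) (Y : I → X →ₗ[ℂ] X) (N : ℕ)
    (hnil : ∀ l : List I, l.length = N → ∀ x, l.foldr (fun i x => Y i x) x = 0)
    (hker : LinearMap.ker π ≤ ⨆ i, LinearMap.range (Y i)) {S T : Submodule ℂ X} (hST : IsCompl S T)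
    (hS : ∀ i, ∀ x ∈ S, Y i x ∈ S) (hT : ∀ i, ∀ x ∈ T, Y i x ∈ T) (h0 : S.map π = ⊥) : S = ⊥ :=
  eq_bot_of_le_iSup_map Y N hnil ((le_inf le_rfl (Submodule.map_le_iff_le_comap.mp h0.le)).trans
    (inf_ker_le_iSup_map π Y hker hST hS hT))

/-- The kernel of `π` is the sum of its intersections with `S` and `T`, as it is spanned by the
images of the `Y_i`. So if `π s = π t`, then `s - t = a + b` with `a ∈ S`, `b ∈ T` in the kernel,
and `s - a = t + b` lies in `S ∩ T = 0`. -/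
theorem isCompl_map_of_isCompl (π : X →ₗ[ℂ] M) (hπ : Function.Surjective π) (Y : I → X →ₗ[ℂ] X)
    (hker : LinearMap.ker π ≤ ⨆ i, LinearMap.range (Y i)) (hY : ∀ i x, π (Y i x) = 0)
    {S T : Submodule ℂ X} (hST : IsCompl S T)
    (hS : ∀ i, ∀ x ∈ S, Y i x ∈ S) (hT : ∀ i, ∀ x ∈ T, Y i x ∈ T) :
    IsCompl (S.map π) (T.map π) := by
  refine ⟨?_, ?_⟩
  · rw [disjoint_iff, eq_bot_iff]
    rintro _ ⟨⟨s, hs, rfl⟩, ⟨t, ht, hst⟩⟩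
    have h1 : ⨆ i, LinearMap.range (Y i) ≤ (S ⊓ LinearMap.ker π) ⊔ (T ⊓ LinearMap.ker π) := by
      refine iSup_le fun i => ?_
      rw [LinearMap.range_eq_map, ← hST.sup_eq_top, Submodule.map_sup]
      refine sup_le_sup ?_ ?_
      · rintro _ ⟨x, hx, rfl⟩; exact ⟨hS i x hx, hY i x⟩
      · rintro _ ⟨x, hx, rfl⟩; exact ⟨hT i x hx, hY i x⟩
    have h2 : s - t ∈ LinearMap.ker π := by
      rw [LinearMap.mem_ker, map_sub, hst, sub_self]
    obtain ⟨a, ⟨haS, ha⟩, b, ⟨hbT, hb⟩, hab⟩ := Submodule.mem_sup.mp (h1 (hker h2))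
    have h3 : s - a = t + b := by
      rw [sub_eq_iff_eq_add, add_assoc, add_comm b, hab, add_sub_cancel]
    have h4 : s - a = 0 := by
      simpa using hST.inf_eq_bot.le ⟨sub_mem hs haS, h3 ▸ add_mem ht hbT⟩
    rw [Submodule.mem_bot, sub_eq_zero.mp h4]
    exact ha
  · rw [codisjoint_iff, ← Submodule.map_sup, hST.sup_eq_top, Submodule.map_top,
      LinearMap.range_eq_top.mpr hπ]

end nilpotent

/-! ### The shift on `J_n(ν)` -/

section jordan

variable {k : Type*} [LieRing k] [LieAlgebra ℂ k] [IsReductive k] (n : ℕ)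
  (ν : Module.Dual ℂ (LieAlgebra.center ℂ k))

namespace Jordan

theorem shift_pow_apply (j : ℕ) (f : Jordan n ν) (i : Fin n) :
    ((shift n ν ^ j) f : Fin n → ℂ) i = if j ≤ i.val then (f : Fin n → ℂ) ⟨i.val - j, by omega⟩
      else 0 := by
  induction j generalizing i with
  | zero => simp
  | succ j ih =>
    rw [pow_succ']
    have h : ((shift n ν * shift n ν ^ j) f : Fin n → ℂ) i = if h : 0 < i.val then
      ((shift n ν ^ j) f : Fin n → ℂ) ⟨i.val - 1, by omega⟩ else 0 := rfl
    rw [h]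
    by_cases h0 : 0 < i.val
    · rw [dif_pos h0, ih]
      by_cases h1 : j + 1 ≤ i.val
      · rw [if_pos h1, if_pos (by simp only; omega)]
        congr 2
        simp only
        omega
      · rw [if_neg h1, if_neg (by simp only; omega)]
    · rw [dif_neg h0, if_neg (by omega)]

/-- Both the image of the `j`-th power and the kernel of the `j'`-th consist of the vectors
supported on indices `≥ j`, indices being counted from `0`. A preimage is obtained by shifting back.
-/
theorem exact_shift_pow (j j' : ℕ) (h : j + j' = n) :
    Function.Exact (shift n ν ^ j) (shift n ν ^ j') := by
  intro f
  constructor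
  · intro hf
    refine ⟨fun i => if h : i.val + j < n then (f : Fin n → ℂ) ⟨i.val + j, h⟩ else 0, ?_⟩
    refine funext fun i => (shift_pow_apply n ν j _ i).trans ?_
    by_cases hi : j ≤ i.val
    · rw [if_pos hi, dif_pos (by simp only; omega)]
      congr 1
      exact Fin.ext (by simp only; omega)
    · rw [if_neg hi]
      have h1 := congrFun hf ⟨i.val + j', by omega⟩
      rw [shift_pow_apply, if_pos (by simp only; omega)] at h1
      refine h1.symm.trans ?_
      congr 1
      exact Fin.ext (by simp only; omega)
  · rintro ⟨f, rfl⟩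
    refine funext fun i => ?_
    rw [← Module.End.mul_apply, ← pow_add, shift_pow_apply, if_neg (by omega)]
    rfl

/-- The powers of the shift, as morphisms of modules. -/
def shiftPow (j : ℕ) : Jordan n ν →ₗ⁅ℂ, k⁆ Jordan n ν where
  toLinearMap := shift n ν ^ j
  map_lie' := by
    intro x f
    change (shift n ν ^ j) ⁅x, f⁆ = ⁅x, (shift n ν ^ j) f⁆
    rw [lie_def, lie_def, map_smul, ← Module.End.mul_apply, ← Module.End.mul_apply, ← pow_succ,
      ← pow_succ']

variable {n}

/-- The last basis vector. -/
def last (hn : 0 < n) : Jordan n ν := (Pi.single ⟨n - 1, by omega⟩ 1 : Fin n → ℂ)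

/-- The first basis vector. -/
def first (hn : 0 < n) : Jordan n ν := (Pi.single ⟨0, hn⟩ 1 : Fin n → ℂ)

/-- The first coordinate. -/
def coord (hn : 0 < n) : Jordan n ν →ₗ[ℂ] ℂ := LinearMap.proj (φ := fun _ : Fin n => ℂ) ⟨0, hn⟩

theorem coord_first (hn : 0 < n) : coord ν hn (first ν hn) = 1 := by
  change (Pi.single (⟨0, hn⟩ : Fin n) (1 : ℂ) : Fin n → ℂ) ⟨0, hn⟩ = 1
  simp

theorem coord_shift (hn : 0 < n) (f : Jordan n ν) : coord ν hn (shift n ν f) = 0 := by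
  have h := shift_pow_apply n ν 1 f ⟨0, hn⟩
  rw [pow_one] at h
  exact h.trans (if_neg (by simp))

/-- The case `(n - 1, 1)` of `exact_shift_pow`: the image of the `(n - 1)`-st power is the line
through `v_n`. -/
theorem exact_last_shift (hn : 0 < n) :
    Function.Exact (LinearMap.toSpanSingleton ℂ (Jordan n ν) (last ν hn)) (shift n ν) := by
  have h := exact_shift_pow n ν (n - 1) 1 (by omega)
  rw [pow_one] at h
  intro f
  rw [h f]
  constructor
  · rintro ⟨f, rfl⟩
    refine ⟨coord ν hn f, ?_⟩
    refine funext fun i => ?_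
    rw [shift_pow_apply]
    change coord ν hn f * (Pi.single (⟨n - 1, _⟩ : Fin n) (1 : ℂ) : Fin n → ℂ) i = _
    by_cases hi : n - 1 ≤ i.val
    · obtain ⟨i, hin⟩ := i
      obtain rfl : i = n - 1 := Nat.le_antisymm (Nat.le_sub_one_of_lt hin) hi
      rw [if_pos hi, Pi.single_eq_same, mul_one]
      change (f : Fin n → ℂ) _ = (f : Fin n → ℂ) _
      congr 1
      exact Fin.ext (by simp)
    · rw [if_neg hi, Pi.single_eq_of_ne (fun h => hi (by rw [h])), mul_zero]
  · rintro ⟨c, rfl⟩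
    refine ⟨c • first ν hn, funext fun i => ?_⟩
    rw [shift_pow_apply]
    change _ = c * (Pi.single (⟨n - 1, _⟩ : Fin n) (1 : ℂ) : Fin n → ℂ) i
    by_cases hi : n - 1 ≤ i.val
    · obtain ⟨i, hin⟩ := i
      obtain rfl : i = n - 1 := Nat.le_antisymm (Nat.le_sub_one_of_lt hin) hi
      rw [if_pos hi, Pi.single_eq_same]
      change c * (Pi.single (⟨0, hn⟩ : Fin n) (1 : ℂ) : Fin n → ℂ) _ = _
      congr 1
      have : (⟨n - 1 - (n - 1), by omega⟩ : Fin n) = ⟨0, hn⟩ := Fin.ext (by simp)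
      rw [this, Pi.single_eq_same]
    · rw [if_neg hi, Pi.single_eq_of_ne (fun h => hi (by rw [h])), mul_zero]

/-- The case `(1, n - 1)` of `exact_shift_pow`: the `(n - 1)`-st power only sees the first
coordinate. -/
theorem exact_shift_coord (hn : 0 < n) : Function.Exact (shift n ν) (coord ν hn) := by
  have h := exact_shift_pow n ν 1 (n - 1) (by omega)
  rw [pow_one] at h
  intro f
  rw [← h f]
  constructor
  · intro h0
    refine funext fun i => ?_
    rw [shift_pow_apply]
    by_cases hi : n - 1 ≤ i.val
    · rw [if_pos hi]
      refine Eq.trans ?_ h0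
      change (f : Fin n → ℂ) _ = (f : Fin n → ℂ) _
      congr 1
      exact Fin.ext (by simp only; omega)
    · rw [if_neg hi]
      rfl
  · intro h0
    obtain ⟨f, rfl⟩ := (h f).mp h0
    exact coord_shift ν hn f

theorem shift_last (hn : 0 < n) : shift n ν (last ν hn) = 0 :=
  (exact_last_shift ν hn _).mpr ⟨1, by simp⟩

end Jordan
end jordan

/-! ### The shift on `L ⊗ J_n(ν)`, its kernel and its cokernel -/

section tensor

variable {k : Type*} [LieRing k] [LieAlgebra ℂ k] [IsReductive k] {n : ℕ}
  (ν : Module.Dual ℂ (LieAlgebra.center ℂ k))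
variable (L : Type*) [AddCommGroup L] [Module ℂ L] [LieRingModule k L] [LieModule ℂ k L]

namespace Jordan

variable (n) in
/-- The powers of the shift on `L ⊗ J_n(ν)`. -/
def tensorShift (j : ℕ) : L ⊗[ℂ] Jordan n ν →ₗ⁅ℂ, k⁆ L ⊗[ℂ] Jordan n ν :=
  TensorProduct.LieModule.map LieModuleHom.id (shiftPow n ν j)

theorem tensorShift_tmul (j : ℕ) (l : L) (f : Jordan n ν) :
    tensorShift n ν L j (l ⊗ₜ f) = l ⊗ₜ (shift n ν ^ j) f := rfl

theorem tensorShift_add (i j : ℕ) :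
    tensorShift n ν L (i + j) = (tensorShift n ν L i).comp (tensorShift n ν L j) := by
  refine LieModuleHom.ext fun t => ?_
  induction t with
  | zero => simp
  | add s t hs ht => rw [map_add, map_add, hs, ht]
  | tmul l f =>
    rw [LieModuleHom.comp_apply, tensorShift_tmul, tensorShift_tmul, tensorShift_tmul, pow_add,
      Module.End.mul_apply]

theorem exact_tensorShift (j j' : ℕ) (h : j + j' = n) :
    Function.Exact (tensorShift n ν L j) (tensorShift n ν L j') := by
  have h1 := Module.Flat.lTensor_exact L (exact_shift_pow n ν j j' h)
  exact h1

/-- The inclusion `L → L ⊗ J_n(ν)`, `l ↦ l ⊗ v_n`. -/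
def tensorLast (hn : 0 < n) : L →ₗ⁅ℂ, k⁆ L ⊗[ℂ] Jordan n ν where
  toLinearMap := (TensorProduct.mk ℂ L (Jordan n ν)).flip (last ν hn)
  map_lie' := by
    intro x l
    change ⁅x, l⁆ ⊗ₜ last ν hn = ⁅x, (l ⊗ₜ last ν hn : L ⊗[ℂ] Jordan n ν)⁆
    rw [TensorProduct.LieModule.lie_tmul_right, lie_def, shift_last, smul_zero,
      TensorProduct.tmul_zero, add_zero]

theorem tensorLast_apply (hn : 0 < n) (l : L) : tensorLast ν L hn l = l ⊗ₜ last ν hn := rfl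

theorem tensorLast_eq (hn : 0 < n) (l : L) : tensorLast ν L hn l =
    LinearMap.lTensor L (LinearMap.toSpanSingleton ℂ (Jordan n ν) (last ν hn))
      ((TensorProduct.rid ℂ L).symm l) := by
  rw [TensorProduct.rid_symm_apply, LinearMap.lTensor_tmul, LinearMap.toSpanSingleton_apply,
    one_smul, tensorLast_apply]

theorem tensorLast_injective (hn : 0 < n) : Function.Injective (tensorLast ν L hn) := by
  have h : Function.Injective (LinearMap.toSpanSingleton ℂ (Jordan n ν) (last ν hn)) := by
    intro c d hcd
    have := congrFun hcd ⟨n - 1, by omega⟩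
    change c * (Pi.single (⟨n - 1, _⟩ : Fin n) (1 : ℂ) : Fin n → ℂ) _ =
      d * (Pi.single (⟨n - 1, _⟩ : Fin n) (1 : ℂ) : Fin n → ℂ) _ at this
    simpa using this
  intro l l' hl
  rw [tensorLast_eq, tensorLast_eq] at hl
  exact (TensorProduct.rid ℂ L).symm.injective
    (Module.Flat.lTensor_preserves_injective_linearMap _ h hl)

theorem exact_tensorLast (hn : 0 < n) :
    Function.Exact (tensorLast ν L hn) (tensorShift n ν L 1) := by
  have h := Module.Flat.lTensor_exact L (exact_last_shift ν hn)
  have h1 : ∀ t, tensorShift n ν L 1 t = LinearMap.lTensor L (shift n ν) t := by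
    intro t
    change LinearMap.lTensor L (shift n ν ^ 1) t = _
    rw [pow_one]
  intro t
  rw [h1, h t]
  constructor
  · rintro ⟨s, rfl⟩
    exact ⟨TensorProduct.rid ℂ L s, by rw [tensorLast_eq, LinearEquiv.symm_apply_apply]⟩
  · rintro ⟨l, rfl⟩
    exact ⟨_, (tensorLast_eq ν L hn l).symm⟩

/-- The projection `L ⊗ J_n(ν) → L` along the first basis vector. -/
def tensorCoord (hn : 0 < n) : L ⊗[ℂ] Jordan n ν →ₗ⁅ℂ, k⁆ L where
  toLinearMap := TensorProduct.rid ℂ L ∘ₗ LinearMap.lTensor L (coord ν hn)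
  map_lie' := by
    intro x t
    change TensorProduct.rid ℂ L (LinearMap.lTensor L (coord ν hn) ⁅x, t⁆) =
      ⁅x, TensorProduct.rid ℂ L (LinearMap.lTensor L (coord ν hn) t)⁆
    induction t with
    | zero => simp
    | add s t hs ht => rw [lie_add, map_add, map_add, hs, ht, map_add, map_add, lie_add]
    | tmul l f =>
      rw [TensorProduct.LieModule.lie_tmul_right, lie_def, map_add, LinearMap.lTensor_tmul,
        LinearMap.lTensor_tmul, LinearMap.lTensor_tmul, map_smul, coord_shift, smul_zero,
        TensorProduct.tmul_zero, add_zero, TensorProduct.rid_tmul, TensorProduct.rid_tmul, lie_smul]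

theorem tensorCoord_tmul (hn : 0 < n) (l : L) (f : Jordan n ν) :
    tensorCoord ν L hn (l ⊗ₜ f) = coord ν hn f • l := rfl

theorem tensorCoord_surjective (hn : 0 < n) : Function.Surjective (tensorCoord ν L hn) :=
  fun l => ⟨l ⊗ₜ first ν hn, by rw [tensorCoord_tmul, coord_first, one_smul]⟩

theorem exact_tensorCoord (hn : 0 < n) :
    Function.Exact (tensorShift n ν L 1) (tensorCoord ν L hn) := by
  have h := Module.Flat.lTensor_exact L (exact_shift_coord ν hn)
  have h1 : ∀ t, tensorShift n ν L 1 t = LinearMap.lTensor L (shift n ν) t := by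
    intro t
    change LinearMap.lTensor L (shift n ν ^ 1) t = _
    rw [pow_one]
  intro t
  have h2 : tensorCoord ν L hn t = 0 ↔ LinearMap.lTensor L (coord ν hn) t = 0 :=
    (TensorProduct.rid ℂ L).map_eq_zero_iff
  rw [h2, h t]
  exact exists_congr fun s => by rw [h1]

theorem exact_tensorLast_tensorCoord (ν : Module.Dual ℂ (LieAlgebra.center ℂ k)) :
    Function.Exact (tensorLast ν L (n := 2) two_pos) (tensorCoord ν L (n := 2) two_pos) := by
  intro t
  rw [exact_tensorCoord ν L two_pos t, ← exact_tensorLast ν L two_pos t]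
  exact (exact_tensorShift (n := 2) ν L 1 1 rfl t).symm

end Jordan
end tensor

/-! ### The filtration by kernels of powers of the shift -/

section filtration

open Jordan

variable {g : Type*} [AddCommGroup g] [Module ℂ g] [LieSuperalgebra g]
  [IsReductive (EvenPart g)] (T : TypeI g)
variable (L : Type*) [AddCommGroup L] [Module ℂ L] [LieRingModule (EvenPart g) L]
  [LieModule ℂ (EvenPart g) L]

theorem hasFiltration_kac (n : ℕ) (ν : Module.Dual ℂ (LieAlgebra.center ℂ (EvenPart g))) :
    HasFiltration g n (Kac T (L ⊗[ℂ] Jordan n ν)) (Kac T L) := by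
  set σ : ℕ → Kac T (L ⊗[ℂ] Jordan n ν) →ₗ[U g] Kac T (L ⊗[ℂ] Jordan n ν) :=
    fun j => Kac.map T (tensorShift n ν L j) with hσ
  have hσadd : ∀ i j x, σ (i + j) x = σ i (σ j x) := fun i j x => by
    rw [hσ]
    simp only
    rw [tensorShift_add, Kac.map_comp]
    rfl
  have hex : ∀ i j, i + j = n → Function.Exact (σ i) (σ j) := fun i j h =>
    Kac.exact_map _ _ (exact_tensorShift ν L i j h)
  have hσ0 : Function.Bijective (tensorShift n ν L 0) := by
    have : ∀ t, tensorShift n ν L 0 t = t := fun t =>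
      LinearMap.congr_fun (LinearMap.lTensor_id L (Jordan n ν)) t
    exact ⟨fun x y h => by rwa [this, this] at h, fun x => ⟨x, this x⟩⟩
  -- Kernels of even maps are graded submodules; here `σ i` is induced by the `i`-th power of the
  -- shift.
  refine ⟨fun i => LinearMap.ker (σ i), ?_, ?_, ?_, ?_, ?_⟩
  · intro i j hij x hx
    have h : (j : ℕ) = (j - i : ℕ) + i := by
      have : (i : ℕ) ≤ j := hij
      omega
    rw [LinearMap.mem_ker] at hx ⊢
    rw [h, hσadd, hx, map_zero]
  · exact LinearMap.ker_eq_bot.mpr (Kac.map_injective _ hσ0.1)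
  · refine eq_top_iff.mpr fun x _ => ?_
    exact (hex 0 n (zero_add n) x).mpr (Kac.map_surjective _ hσ0.2 x)
  · intro i x hx
    rw [LinearMap.mem_ker] at hx ⊢
    exact (Kac.isEvenMap_map (tensorShift n ν L i) x).trans ((congrArg _ hx).trans (map_zero _))
  · intro i
    have hn : 0 < n := i.pos
    set inc := Kac.map T (tensorLast ν L hn) with hinc
    have hincj : Function.Injective inc := Kac.map_injective _ (tensorLast_injective ν L hn)
    have hincx : Function.Exact inc (σ 1) := Kac.exact_map _ _ (exact_tensorLast ν L hn)
    have hmem : ∀ x : LinearMap.ker (σ i.succ), σ i x ∈ LinearMap.range inc := fun x => by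
      refine (hincx _).mp ?_
      rw [← hσadd, add_comm]
      exact x.2
    -- `σ i` sends `F_{i+1}` into `ker (σ 1)`, which is the copy of `K(L)` embedded by `inc`;
    -- undoing `inc` gives a map with kernel `F_i`.
    let ψ : LinearMap.ker (σ i.succ) →ₗ[U g] Kac T L :=
      (LinearEquiv.ofInjective inc hincj).symm.toLinearMap ∘ₗ
        LinearMap.codRestrict (LinearMap.range inc) (σ i ∘ₗ (LinearMap.ker (σ i.succ)).subtype) hmem
    have hψ : ∀ x, inc (ψ x) = σ i x := fun x =>
      congrArg Subtype.val ((LinearEquiv.ofInjective inc hincj).apply_symm_apply ⟨σ i x, hmem x⟩)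
    have hker : (LinearMap.ker (σ i.castSucc)).submoduleOf (LinearMap.ker (σ i.succ)) =
        LinearMap.ker ψ := by
      ext x
      rw [LinearMap.mem_ker, ← hincj.eq_iff, hψ, map_zero]
      rfl
    have hsurj : Function.Surjective ψ := by
      intro z
      have h1 : σ 1 (inc z) = 0 := (hincx _).mpr ⟨z, rfl⟩
      -- Since `i < n`, the exponent `n - i` is at least `1`; exactness of `σ i`, `σ (n - i)` then
      -- provides a preimage under `σ i`.
      have h2 : σ (n - i) (inc z) = 0 := by
        have : n - (i : ℕ) = (n - i - 1) + 1 := by have := i.2; omega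
        rw [this, hσadd, h1, map_zero]
      obtain ⟨u, hu⟩ := (hex i (n - i) (by have := i.2; omega) _).mp h2
      have hu' : u ∈ LinearMap.ker (σ i.succ) := by
        rw [LinearMap.mem_ker, Fin.val_succ, add_comm, hσadd, hu, h1]
      exact ⟨⟨u, hu'⟩, hincj ((hψ _).trans hu)⟩
    refine ⟨(Submodule.quotEquivOfEq _ _ hker).trans (ψ.quotKerEquivOfSurjective hsurj), ?_⟩
    intro x y hxy
    change ψ y = SuperModule.parity (g := g) (ψ x)
    refine hincj ?_
    rw [hψ, hxy, Kac.isEvenMap_map (tensorLast ν L hn), hψ]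
    exact Kac.isEvenMap_map (tensorShift n ν L i) _

end filtration

/-! ### Indecomposability of `K(M)` and of `L ⊗ J_n(ν)` -/

section indecomposable

open Jordan

variable {g : Type*} [AddCommGroup g] [Module ℂ g] [LieSuperalgebra g] (T : TypeI g)
variable {M : Type*} [AddCommGroup M] [Module ℂ M] [LieRingModule (EvenPart g) M]
  [LieModule ℂ (EvenPart g) M]

/-- The image of a submodule of `K(M)` under the projection `K(M) → M`. -/
def Kac.projSubmodule (S : Submodule (U g) (Kac T M)) : LieSubmodule ℂ (EvenPart g) M where
  toSubmodule := (S.restrictScalars ℂ).map (Kac.proj T M)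
  lie_mem := by
    rintro a _ ⟨s, hs, rfl⟩
    exact ⟨(ι a.1 : U g) • s, S.smul_mem _ hs, Kac.proj_even_smul a s⟩

/-- The Kac module of an indecomposable module is indecomposable. -/
theorem isIndecomposable_kac [FiniteDimensional ℂ g] (hM : IsLieIndecomposable (EvenPart g) M) :
    IsIndecomposable (U g) (Kac T M) := by
  have := hM.1
  refine ⟨Kac.mk_injective.nontrivial (f := Kac.mk T M), fun S S' hS => ?_⟩
  have hST : IsCompl (S.restrictScalars ℂ) (S'.restrictScalars ℂ) := by
    refine ⟨?_, ?_⟩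
    · rw [disjoint_iff, eq_bot_iff]
      intro x hx
      exact hS.disjoint.le_bot hx
    · rw [codisjoint_iff, eq_top_iff]
      intro x _
      obtain ⟨a, ha, b, hb, rfl⟩ := Submodule.mem_sup.mp
        (show x ∈ S ⊔ S' by rw [hS.sup_eq_top]; trivial)
      exact add_mem (Submodule.mem_sup_left ha) (Submodule.mem_sup_right hb)
  have hstab : ∀ (R : Submodule (U g) (Kac T M)) (y : T.neg), ∀ x ∈ R.restrictScalars ℂ,
      Kac.negOp T M y x ∈ R.restrictScalars ℂ := fun R y x hx => R.smul_mem _ hx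
  have hc := isCompl_map_of_isCompl (Kac.proj T M) (fun m => ⟨_, Kac.proj_mk m⟩) (Kac.negOp T M)
    Kac.ker_proj_le Kac.proj_neg_smul hST (hstab S) (hstab S')
  have hc' : IsCompl (Kac.projSubmodule T S) (Kac.projSubmodule T S') := by
    refine ⟨?_, ?_⟩
    · rw [disjoint_iff, ← LieSubmodule.toSubmodule_inj, LieSubmodule.inf_toSubmodule]
      exact hc.inf_eq_bot
    · rw [codisjoint_iff, ← LieSubmodule.toSubmodule_inj, LieSubmodule.sup_toSubmodule]
      exact hc.sup_eq_top
  have hnil : ∀ l : List T.neg, l.length = Module.finrank ℂ T.neg + 1 → ∀ x,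
      l.foldr (fun i x => Kac.negOp T M i x) x = 0 := fun l hl x =>
    Kac.foldr_negOp_eq_zero l (by omega) x
  have hbot : ∀ {R R' : Submodule (U g) (Kac T M)},
      IsCompl (R.restrictScalars ℂ) (R'.restrictScalars ℂ) →
      Kac.projSubmodule T R = ⊥ → R = ⊥ := by
    intro R R' hRR h
    have h1 := eq_bot_of_map_eq_bot (Kac.proj T M) (Kac.negOp T M) _ hnil Kac.ker_proj_le hRR
      (hstab R) (hstab R') (congrArg LieSubmodule.toSubmodule h)
    exact (Submodule.eq_bot_iff _).mpr fun x hx => (Submodule.eq_bot_iff _).mp h1 x hx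
  exact (hM.2 _ _ hc').imp (hbot hST) (hbot hST.symm)

variable {k : Type*} [LieRing k] [LieAlgebra ℂ k] [IsReductive k] {n : ℕ}
  (ν : Module.Dual ℂ (LieAlgebra.center ℂ k))
variable {L : Type*} [AddCommGroup L] [Module ℂ L] [LieRingModule k L] [LieModule ℂ k L]

theorem extendCenter_center (z : LieAlgebra.center ℂ k) : extendCenter ν (z : k) = ν z := by
  rw [extendCenter, LinearMap.comp_apply,
    Submodule.projectionOnto_apply_of_mem_left (isCompl_center k) z.2]
  rfl

/-- Used to express the shift through the action of `k`: if `ν z ≠ 0` it is `(z - c) / ν z`, so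
every submodule is stable under it. -/
theorem lie_center_tensor (z : LieAlgebra.center ℂ k) (c : ℂ)
    (hz : ∀ m : L, ⁅(z : k), m⁆ = c • m) (t : L ⊗[ℂ] Jordan n ν) :
    ⁅(z : k), t⁆ = c • t + ν z • tensorShift n ν L 1 t := by
  induction t with
  | zero => simp
  | add s t hs ht => rw [lie_add, hs, ht, map_add, smul_add, smul_add]; abel
  | tmul l f =>
    rw [TensorProduct.LieModule.lie_tmul_right, hz, Jordan.lie_def, extendCenter_center,
      tensorShift_tmul, pow_one, TensorProduct.tmul_smul, TensorProduct.smul_tmul',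
      TensorProduct.smul_tmul']

/-- `L ⊗ J_n(ν)` is indecomposable if `L` is and some central element acts on `L` by a scalar and
on `J_n(ν)` by a single Jordan block. -/
theorem isLieIndecomposable_tensor (hn : 0 < n) (hL : IsLieIndecomposable k L)
    (h : n = 1 ∨ ∃ z : LieAlgebra.center ℂ k, ν z ≠ 0 ∧ ∃ c : ℂ, ∀ m : L, ⁅(z : k), m⁆ = c • m) :
    IsLieIndecomposable k (L ⊗[ℂ] Jordan n ν) := by
  have := hL.1
  have hn0 : ∀ t, tensorShift n ν L n t = 0 := fun t => by
    refine (exact_tensorShift ν L 0 n (zero_add n) t).mpr ⟨t, ?_⟩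
    exact LinearMap.congr_fun (LinearMap.lTensor_id L (Jordan n ν)) t
  have hstab : ∀ (R : LieSubmodule ℂ k (L ⊗[ℂ] Jordan n ν)) (_ : Unit), ∀ x ∈ R.toSubmodule,
      (tensorShift n ν L 1 : L ⊗[ℂ] Jordan n ν →ₗ[ℂ] L ⊗[ℂ] Jordan n ν) x ∈ R.toSubmodule := by
    rintro R - x hx
    change tensorShift n ν L 1 x ∈ R
    -- For `n = 1` the shift is zero, so stability needs no central element.
    rcases h with rfl | ⟨z, hz, c, hc⟩
    · rw [hn0]
      exact zero_mem R
    · have h1 := lie_center_tensor ν z c hc x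
      have h2 : tensorShift n ν L 1 x = (ν z)⁻¹ • (⁅(z : k), x⁆ - c • x) := by
        rw [h1, add_sub_cancel_left, smul_smul, inv_mul_cancel₀ hz, one_smul]
      rw [h2]
      exact R.smul_mem _ (sub_mem (R.lie_mem hx) (R.smul_mem _ hx))
  refine ⟨(tensorLast_injective ν L hn).nontrivial, fun S S' hS => ?_⟩
  have hST : IsCompl S.toSubmodule S'.toSubmodule := by
    refine ⟨?_, ?_⟩
    · rw [disjoint_iff, ← LieSubmodule.inf_toSubmodule, hS.inf_eq_bot, LieSubmodule.bot_toSubmodule]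
    · rw [codisjoint_iff, ← LieSubmodule.sup_toSubmodule, hS.sup_eq_top,
        LieSubmodule.top_toSubmodule]
  have hker : LinearMap.ker (tensorCoord ν L hn : L ⊗[ℂ] Jordan n ν →ₗ[ℂ] L) ≤ ⨆ _ : Unit,
      LinearMap.range (tensorShift n ν L 1 : L ⊗[ℂ] Jordan n ν →ₗ[ℂ] L ⊗[ℂ] Jordan n ν) := by
    intro x hx
    obtain ⟨y, hy⟩ := (exact_tensorCoord ν L hn x).mp hx
    exact Submodule.mem_iSup_of_mem () ⟨y, hy⟩
  have hc := isCompl_map_of_isCompl (tensorCoord ν L hn : L ⊗[ℂ] Jordan n ν →ₗ[ℂ] L)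
    (tensorCoord_surjective ν L hn) (fun _ : Unit => (tensorShift n ν L 1 :
      L ⊗[ℂ] Jordan n ν →ₗ[ℂ] L ⊗[ℂ] Jordan n ν)) hker
    (fun _ x => (exact_tensorCoord ν L hn _).mpr ⟨x, rfl⟩) hST (hstab S) (hstab S')
  have hc' : IsCompl (S.map (tensorCoord ν L hn)) (S'.map (tensorCoord ν L hn)) := by
    refine ⟨?_, ?_⟩
    · rw [disjoint_iff, ← LieSubmodule.toSubmodule_inj, LieSubmodule.inf_toSubmodule]
      exact hc.inf_eq_bot
    · rw [codisjoint_iff, ← LieSubmodule.toSubmodule_inj, LieSubmodule.sup_toSubmodule]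
      exact hc.sup_eq_top
  have hnil : ∀ l : List Unit, l.length = n → ∀ x, l.foldr (fun (_ : Unit) x =>
      (tensorShift n ν L 1 : L ⊗[ℂ] Jordan n ν →ₗ[ℂ] L ⊗[ℂ] Jordan n ν) x) x = 0 := by
    have : ∀ (l : List Unit) x, l.foldr (fun (_ : Unit) x => (tensorShift n ν L 1 :
        L ⊗[ℂ] Jordan n ν →ₗ[ℂ] L ⊗[ℂ] Jordan n ν) x) x = tensorShift n ν L l.length x := by
      intro l x
      induction l with
      | nil => exact (LinearMap.congr_fun (LinearMap.lTensor_id L (Jordan n ν)) x).symm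
      | cons u l ih =>
        rw [List.foldr_cons, ih, List.length_cons, add_comm, tensorShift_add]
        rfl
    rintro l rfl x
    rw [this, hn0]
  have hbot : ∀ {R R' : LieSubmodule ℂ k (L ⊗[ℂ] Jordan n ν)},
      IsCompl R.toSubmodule R'.toSubmodule → R.map (tensorCoord ν L hn) = ⊥ → R = ⊥ := by
    intro R R' hRR h
    have h1 := eq_bot_of_map_eq_bot (tensorCoord ν L hn : L ⊗[ℂ] Jordan n ν →ₗ[ℂ] L)
      (fun _ : Unit => (tensorShift n ν L 1 : L ⊗[ℂ] Jordan n ν →ₗ[ℂ] L ⊗[ℂ] Jordan n ν)) n hnil hker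
      hRR (hstab R) (hstab R') (congrArg LieSubmodule.toSubmodule h)
    rwa [← LieSubmodule.toSubmodule_inj]
  exact (hL.2 _ _ hc').imp (hbot hST) (hbot hST.symm)

end indecomposable

/-! ### Semisimplicity of `h` in an `sl₂`-triple -/

section sl2

variable {k M : Type*} [LieRing k] [LieAlgebra ℂ k] [AddCommGroup M] [Module ℂ M]
  [LieRingModule k M] [LieModule ℂ k M] [FiniteDimensional ℂ M] {h e f : k}

open LieModule

/-- Otherwise these would be infinitely many eigenvectors with distinct eigenvalues, impossible in
finite dimension. -/
theorem exists_eq_zero_of_eigen (A : Module.End ℂ M) (x : ℕ → M) (a c : ℂ) (hc : c ≠ 0)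
    (hx : ∀ n : ℕ, A (x n) = (a + n * c) • x n) : ∃ n, x n = 0 := by
  by_contra! hne
  have hli := Module.End.eigenvectors_linearIndependent' A (fun n : ℕ => a + n * c)
    (fun m n hmn => by simpa [hc] using hmn) x
    (fun n => ⟨Module.End.mem_eigenspace_iff.mpr (hx n), hne n⟩)
  exact Set.infinite_univ (Set.finite_univ_iff.mpr hli.finite)

theorem lie_h_pow_e (t : IsSl2Triple h e f) {a : ℂ} {w u : M} (hw : ⁅h, w⁆ = a • w + u) (n : ℕ) :
    ⁅h, (toEnd ℂ k M e ^ n) w⁆ =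
      (a + n * 2) • (toEnd ℂ k M e ^ n) w + (toEnd ℂ k M e ^ n) u := by
  induction n with
  | zero => simpa using hw
  | succ n ih =>
    rw [pow_succ', Module.End.mul_apply, Module.End.mul_apply, toEnd_apply_apply,
      toEnd_apply_apply, leibniz_lie, t.lie_h_e_smul ℂ, smul_lie, ih, lie_add, lie_smul,
      ← add_assoc, ← add_smul]
    congr 2
    push_cast
    ring

theorem lie_h_pow_f (t : IsSl2Triple h e f) {a : ℂ} {w u : M} (hw : ⁅h, w⁆ = a • w + u) (n : ℕ) :
    ⁅h, (toEnd ℂ k M f ^ n) w⁆ =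
      (a + n * (-2)) • (toEnd ℂ k M f ^ n) w + (toEnd ℂ k M f ^ n) u := by
  have h1 : ⁅-h, w⁆ = (-a) • w + -u := by rw [neg_lie, hw, neg_add, neg_smul]
  have h2 := lie_h_pow_e t.symm h1 n
  rw [neg_lie, map_neg] at h2
  rw [← neg_inj, h2, neg_add, ← neg_smul]
  congr 2
  ring

theorem lie_e_pow_f (t : IsSl2Triple h e f) {a : ℂ} {w u : M} (hw : ⁅h, w⁆ = a • w + u)
    (he : ⁅e, w⁆ = 0) (n : ℕ) :
    ⁅e, (toEnd ℂ k M f ^ (n + 1)) w⁆ =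
      ((n + 1) * (a - n)) • (toEnd ℂ k M f ^ n) w + (n + 1 : ℂ) • (toEnd ℂ k M f ^ n) u := by
  induction n with
  | zero =>
    rw [zero_add, pow_one, toEnd_apply_apply, leibniz_lie, t.lie_e_f, he, lie_zero, hw]
    simp
  | succ n ih =>
    rw [pow_succ', Module.End.mul_apply, toEnd_apply_apply, leibniz_lie, t.lie_e_f, ih,
      lie_h_pow_f t hw, lie_add, lie_smul, lie_smul, ← toEnd_apply_apply ℂ k M f,
      ← toEnd_apply_apply ℂ k M f, ← Module.End.mul_apply, ← Module.End.mul_apply, ← pow_succ']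
    push_cast
    module

theorem pow_e_lie_f (t : IsSl2Triple h e f) {b : ℂ} {y : M} (hy : ⁅h, y⁆ = b • y) (n : ℕ) :
    (toEnd ℂ k M e ^ (n + 1)) ⁅f, y⁆ = ⁅f, (toEnd ℂ k M e ^ (n + 1)) y⁆ +
      ((n + 1) * (b + n)) • (toEnd ℂ k M e ^ n) y := by
  induction n with
  | zero =>
    rw [zero_add, pow_one, toEnd_apply_apply, toEnd_apply_apply, leibniz_lie e f, t.lie_e_f, hy]
    simp [add_comm]
  | succ n ih =>
    have h1 := t.lie_h_pow_toEnd_e hy (n + 1)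
    rw [pow_succ', Module.End.mul_apply, ih, map_add, map_smul, toEnd_apply_apply, leibniz_lie e f,
      t.lie_e_f, h1, ← toEnd_apply_apply ℂ k M e, ← Module.End.mul_apply, ← pow_succ',
      ← Module.End.mul_apply, ← pow_succ', add_right_comm, add_comm, add_assoc, ← add_smul, add_comm]
    rw [add_comm]
    congr 2
    push_cast
    ring

/-- Here `a` is a natural number `n`, with `f^n u ≠ 0` and `f^(n+1) u = 0`. Once `f^(n+1) w = 0` is
known, applying `e` to it gives `(n+1) f^n u = 0`, the coefficient `(n+1)(a-n)` of `f^n w` being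
zero; this is a contradiction. -/
theorem not_jordan_of_lie_e_eq_zero (t : IsSl2Triple h e f) {a : ℂ} {w u : M}
    (hw : ⁅h, w⁆ = a • w + u) (he : ⁅e, w⁆ = 0) (hu : t.HasPrimitiveVectorWith u a) : False := by
  obtain ⟨n, hn⟩ := hu.exists_nat
  have hu0 := hu.pow_toEnd_f_ne_zero_of_eq_nat hn le_rfl
  have hu1 := hu.pow_toEnd_f_eq_zero_of_eq_nat hn
  have hu2 : ∀ j, (toEnd ℂ k M f ^ (n + 1 + j)) u = 0 := fun j => by
    rw [add_comm, pow_add, Module.End.mul_apply, hu1, map_zero]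
  obtain ⟨j, hj⟩ := exists_eq_zero_of_eigen (toEnd ℂ k M h)
    (fun j => (toEnd ℂ k M f ^ (n + 1 + j)) w) (a + (n + 1) * (-2)) (-2) (by norm_num) (fun j => by
      simp only [toEnd_apply_apply]
      rw [lie_h_pow_f t hw, hu2, add_zero]
      congr 1
      push_cast
      ring)
  -- Beyond the exponent `n` the vectors `f^m w` are killed by `h - (a - 2m)`, so one of them is
  -- zero. Applying `e` lowers the exponent with coefficient `(m+1)(n-m)`, nonzero for `m > n`,
  -- which brings the vanishing down to `f^(n+1) w`.
  have key : ∀ j, (toEnd ℂ k M f ^ (n + 1 + j)) w = 0 → (toEnd ℂ k M f ^ (n + 1)) w = 0 := by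
    intro j
    induction j with
    | zero => exact id
    | succ j ih =>
      intro hj
      apply ih
      have h1 := lie_e_pow_f t hw he (n + 1 + j)
      rw [add_assoc _ j 1, hj, lie_zero, hu2, smul_zero, add_zero] at h1
      refine (smul_eq_zero.mp h1.symm).resolve_left (mul_ne_zero ?_ ?_)
      · exact_mod_cast Nat.succ_ne_zero (n + 1 + j)
      · rw [hn]
        push_cast
        intro h0
        have : (1 + j : ℂ) = 0 := by linear_combination -h0
        have : ((1 + j : ℕ) : ℂ) = 0 := by push_cast; exact this
        have := Nat.cast_eq_zero.mp this
        omega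
  have h1 := lie_e_pow_f t hw he n
  rw [key j hj, lie_zero, hn, sub_self, mul_zero, zero_smul, zero_add] at h1
  exact hu0 ((smul_eq_zero.mp h1.symm).resolve_left (by exact_mod_cast Nat.succ_ne_zero n))

/-- Reduction to `ew = 0`: as long as only a higher power of `e` kills `w`, a correction by `few`
lowers that power and rescales `u` by a nonzero factor. -/
theorem not_jordan_of_primitive (t : IsSl2Triple h e f) {a : ℂ} (r : ℕ) {w u : M}
    (hw : ⁅h, w⁆ = a • w + u) (he : (toEnd ℂ k M e ^ (r + 1)) w = 0)
    (hu : t.HasPrimitiveVectorWith u a) : False := by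
  induction r generalizing w u with
  | zero => exact not_jordan_of_lie_e_eq_zero t hw (by simpa using he) hu
  | succ r ih =>
    obtain ⟨n, hn⟩ := hu.exists_nat
    have hew : ⁅h, ⁅e, w⁆⁆ = (a + 2) • ⁅e, w⁆ := by
      have := lie_h_pow_e t hw 1
      simpa [hu.lie_e] using this
    have hfew : ⁅h, ⁅f, ⁅e, w⁆⁆⁆ = a • ⁅f, ⁅e, w⁆⁆ := by
      have := lie_h_pow_f t (w := ⁅e, w⁆) (u := 0) (a := a + 2) (by rw [hew, add_zero]) 1
      simpa using this
    -- Since `eu = 0`, the vector `ew` has weight `a + 2`; when `e^(r+1)` is moved past `f` in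
    -- `few`, the commutator contributes `s • e^(r+1) w`. Subtracting `s • w` cancels it, and `s ≠
    -- 0` because `a` is a natural number.
    set s : ℂ := (r + 1) * (a + 2 + r) with hs
    have hs0 : s ≠ 0 := by
      rw [hs, hn]
      have : ((r + 1) * (n + 2 + r) : ℕ) ≠ 0 := by positivity
      exact_mod_cast this
    refine ih (w := ⁅f, ⁅e, w⁆⁆ - s • w) (u := -(s • u)) ?_ ?_ ?_
    · rw [lie_sub, hfew, lie_smul, hw]
      module
    · have h1 := pow_e_lie_f t hew r
      have h2 : (toEnd ℂ k M e ^ (r + 1)) ⁅e, w⁆ = 0 := by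
        rw [← toEnd_apply_apply ℂ k M e, ← Module.End.mul_apply, ← pow_succ]
        exact he
      have h3 : (toEnd ℂ k M e ^ r) ⁅e, w⁆ = (toEnd ℂ k M e ^ (r + 1)) w := by
        rw [← toEnd_apply_apply ℂ k M e, ← Module.End.mul_apply, ← pow_succ]
      rw [map_sub, h1, h2, lie_zero, zero_add, h3, map_smul, sub_self]
    · refine ⟨?_, ?_, ?_⟩
      · rw [neg_ne_zero]
        exact smul_ne_zero hs0 hu.ne_zero
      · rw [lie_neg, lie_smul, hu.lie_h, smul_neg, smul_comm]
      · rw [lie_neg, lie_smul, hu.lie_e, smul_zero, neg_zero]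

/-- The element `h` of an `sl₂`-triple acts semisimply on finite-dimensional modules. -/
theorem eq_zero_of_isSl2Triple (t : IsSl2Triple h e f) {a : ℂ} {w u : M}
    (hw : ⁅h, w⁆ = a • w + u) (hu : ⁅h, u⁆ = a • u) : u = 0 := by
  by_contra hu0
  have hu' : ∀ n : ℕ, ⁅h, (toEnd ℂ k M e ^ n) u⁆ = (a + n * 2) • (toEnd ℂ k M e ^ n) u := fun n => by
    have := lie_h_pow_e t (w := u) (u := 0) (by rw [hu, add_zero]) n
    rwa [map_zero, add_zero] at this
  -- The relation between `w` and `u` survives applying `e^n`, with `a` replaced by `a + 2n`. The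
  -- last `n` with `e^n u ≠ 0` makes `e^n u` primitive.
  obtain ⟨n, hn0, hn1⟩ := Nat.exists_not_and_succ_of_not_zero_of_exists
    (p := fun n => (toEnd ℂ k M e ^ n) u = 0) hu0
    (exists_eq_zero_of_eigen (toEnd ℂ k M h) (fun n => (toEnd ℂ k M e ^ n) u) a 2 two_ne_zero hu')
  have hu2 : ∀ j, (toEnd ℂ k M e ^ (n + 1 + j)) u = 0 := fun j => by
    rw [add_comm, pow_add, Module.End.mul_apply, hn1, map_zero]
  obtain ⟨r, hr⟩ := exists_eq_zero_of_eigen (toEnd ℂ k M h)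
    (fun j => (toEnd ℂ k M e ^ (n + 1 + j)) w) (a + (n + 1) * 2) 2 two_ne_zero (fun j => by
      simp only [toEnd_apply_apply]
      rw [lie_h_pow_e t hw, hu2, add_zero]
      congr 1
      push_cast
      ring)
  refine not_jordan_of_primitive t r (lie_h_pow_e t hw n) ?_ ⟨hn0, hu' n, ?_⟩
  · rw [← Module.End.mul_apply, ← pow_add]
    convert hr using 3
    omega
  · rw [← toEnd_apply_apply ℂ k M e, ← Module.End.mul_apply, ← pow_succ', hn1]

end sl2

/-! ### Reductive Lie algebras, Cartan subalgebras and coroots -/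

section reductive

variable {k : Type*} [LieRing k] [LieAlgebra ℂ k]

variable (k) in
/-- The derived algebra of a Lie algebra, as an ideal. -/
abbrev derivedIdeal : LieIdeal ℂ k := ⁅(⊤ : LieIdeal ℂ k), (⊤ : LieIdeal ℂ k)⁆

/-- The derived algebra of a reductive Lie algebra is semisimple. -/
instance hasTrivialRadical_derivedIdeal [hk : IsReductive k] :
    LieAlgebra.HasTrivialRadical ℂ (derivedIdeal k) := by
  have hcl := hk.complemented
  rw [LieAlgebra.hasTrivialRadical_iff_no_abelian_ideals]
  intro I hI
  have hZD := isCompl_center k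
  have hdec : ∀ x : k, ∃ z ∈ LieAlgebra.center ℂ k, ∃ d ∈ derivedIdeal k, x = z + d := by
    intro x
    obtain ⟨z, hz, d, hd, rfl⟩ := Submodule.mem_sup.mp
      (show x ∈ (LieAlgebra.center ℂ k).toSubmodule ⊔ (derivedIdeal k).toSubmodule by
        rw [hZD.sup_eq_top]; trivial)
    exact ⟨z, hz, d, hd, rfl⟩
  have hZ : ∀ z ∈ LieAlgebra.center ℂ k, ∀ x : k, ⁅z, x⁆ = 0 := fun z hz x => by
    rw [← lie_skew, hz x, neg_zero]
  -- An ideal of `[k,k]` is an ideal of `k`, since the centre acts by zero. If it is abelian, it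
  -- commutes with itself and with a complementary ideal, so it is central and meets `[k,k]`
  -- trivially.
  let I' : LieIdeal ℂ k :=
    { toSubmodule := I.toSubmodule.map (derivedIdeal k).toSubmodule.subtype
      lie_mem := by
        rintro x _ ⟨y, hy, rfl⟩
        obtain ⟨z, hz, d, hd, rfl⟩ := hdec x
        refine ⟨⁅(⟨d, hd⟩ : derivedIdeal k), y⁆, lie_mem_right ℂ _ I _ _ hy, ?_⟩
        change ⁅d, (y : k)⁆ = ⁅z + d, (y : k)⁆
        rw [add_lie, hZ z hz, zero_add] }
  have hI' : ∀ x ∈ I', ∀ y ∈ I', ⁅x, y⁆ = 0 := by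
    rintro _ ⟨x, hx, rfl⟩ _ ⟨y, hy, rfl⟩
    have := congrArg (fun z : I => ((z : derivedIdeal k) : k))
      (LieModule.IsTrivial.trivial (⟨x, hx⟩ : I) (⟨y, hy⟩ : I))
    exact this
  obtain ⟨J, hJ⟩ := exists_isCompl I'
  have hcen : ∀ x ∈ I', x ∈ LieAlgebra.center ℂ k := by
    intro x hx y
    obtain ⟨a, ha, b, hb, rfl⟩ := (LieSubmodule.mem_sup _ _ _).mp
      (show y ∈ I' ⊔ J by rw [hJ.sup_eq_top]; trivial)
    rw [add_lie, hI' a ha x hx, zero_add]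
    have : ⁅b, x⁆ ∈ I' ⊓ J := ⟨lie_mem_right ℂ k I' b x hx, lie_mem_left ℂ k J b x hb⟩
    rwa [hJ.inf_eq_bot, LieSubmodule.mem_bot] at this
  rw [LieSubmodule.eq_bot_iff]
  intro x hx
  have h1 : (x : k) ∈ LieAlgebra.center ℂ k := hcen x ⟨x, hx, rfl⟩
  have h2 : (x : k) ∈ (⊥ : Submodule ℂ k) := hZD.inf_eq_bot ▸ ⟨h1, x.2⟩
  exact Subtype.ext h2

variable (H : LieSubalgebra ℂ k)

/-- A central element normalizes `H`, and `H` is its own normalizer. -/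
theorem center_le_of_isCartanSubalgebra [H.IsCartanSubalgebra] {z : k}
    (hz : z ∈ LieAlgebra.center ℂ k) : z ∈ H := by
  rw [← LieSubalgebra.IsCartanSubalgebra.self_normalizing (H := H),
    LieSubalgebra.mem_normalizer_iff]
  intro y _
  rw [← lie_skew, hz y, neg_zero]
  exact zero_mem H

/-- The intersection of a Cartan subalgebra with the derived algebra. -/
abbrev derivedCartan : LieSubalgebra ℂ (derivedIdeal k) := H.comap (derivedIdeal k).incl

/-- The inclusion `H ∩ [k, k] → H`. -/
def derivedCartanHom : derivedCartan H →ₗ⁅ℂ⁆ H where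
  toFun x := ⟨x.1.1, x.2⟩
  map_add' _ _ := rfl
  map_smul' _ _ := rfl
  map_lie' := rfl

theorem exists_center_add_derived [IsReductive k] [H.IsCartanSubalgebra] (x : H) :
    ∃ (z : LieAlgebra.center ℂ k) (d : derivedCartan H), (x : k) = z + (d : derivedIdeal k) := by
  obtain ⟨z, hz, d, hd, hx⟩ := Submodule.mem_sup.mp
    (show (x : k) ∈ (LieAlgebra.center ℂ k).toSubmodule ⊔ (derivedIdeal k).toSubmodule by
      rw [(isCompl_center k).sup_eq_top]; trivial)
  have hdH : d ∈ H := by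
    have := sub_mem x.2 (center_le_of_isCartanSubalgebra H hz)
    rwa [← hx, add_sub_cancel_left] at this
  exact ⟨⟨z, hz⟩, ⟨⟨d, hd⟩, hdH⟩, hx.symm⟩

instance isCartanSubalgebra_derivedCartan [IsReductive k] [H.IsCartanSubalgebra] :
    (derivedCartan H).IsCartanSubalgebra where
  nilpotent := by
    have hinj : Function.Injective (derivedCartanHom H) := by
      intro x y hxy
      exact Subtype.ext (Subtype.ext (congrArg (fun z : H => (z : k)) hxy))
    exact hinj.lieAlgebra_isNilpotent
  self_normalizing := by
    refine le_antisymm ?_ (LieSubalgebra.le_normalizer _)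
    intro x hx
    rw [LieSubalgebra.mem_normalizer_iff] at hx
    change (x : k) ∈ H
    rw [← LieSubalgebra.IsCartanSubalgebra.self_normalizing (H := H),
      LieSubalgebra.mem_normalizer_iff]
    intro y hy
    obtain ⟨z, d, hzd⟩ := exists_center_add_derived H ⟨y, hy⟩
    change y = _ at hzd
    rw [hzd, lie_add, z.2 (x : k), zero_add]
    exact hx d d.2

/-- A functional that describes a non-split self-extension of a weight of a finite-dimensional
module vanishes on the intersection of the Cartan subalgebra with the derived algebra. -/
theorem eq_zero_of_mem_derivedIdeal [IsReductive k] [FiniteDimensional ℂ k] [H.IsCartanSubalgebra]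
    {M : Type*} [AddCommGroup M] [Module ℂ M] [LieRingModule k M] [LieModule ℂ k M]
    [FiniteDimensional ℂ M] {lam μ : Module.Dual ℂ H} {w u : M} (hu0 : u ≠ 0)
    (hw : ∀ h : H, ⁅(h : k), w⁆ = lam h • w + μ h • u) (hu : ∀ h : H, ⁅(h : k), u⁆ = lam h • u)
    (h : H) (hh : (h : k) ∈ derivedIdeal k) : μ h = 0 := by
  have hzero : μ ∘ₗ (derivedCartanHom H : derivedCartan H →ₗ[ℂ] H) = 0 := by
    -- Coroots span the Cartan subalgebra of the semisimple algebra `[k,k]`, and each is the `h` of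
    -- an `sl₂`-triple. A nonzero value on it would be a Jordan block for `h`.
    refine LinearMap.ext_on (RootPairing.IsRootSystem.span_coroot_eq_top
      (P := LieAlgebra.IsKilling.rootSystem (derivedCartan H))) ?_
    rintro _ ⟨α, rfl⟩
    rw [LieAlgebra.IsKilling.rootSystem_coroot_apply]
    have hα := LieSubalgebra.isNonZero_coe_root α
    obtain ⟨h', e, f, t, he, hf⟩ := LieAlgebra.IsKilling.exists_isSl2Triple_of_weight_isNonZero hα
    have hcor := t.h_eq_coroot hα he hf
    have t' : IsSl2Triple (h' : k) (e : k) (f : k) :=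
      ⟨fun h0 => t.h_ne_zero (Subtype.ext h0), congrArg Subtype.val t.lie_e_f,
        congrArg Subtype.val t.lie_h_e_nsmul, congrArg Subtype.val t.lie_h_f_nsmul⟩
    set c := derivedCartanHom H (LieAlgebra.IsKilling.coroot (α : LieModule.Weight ℂ _ _))
    have hc : (h' : k) = c := by rw [hcor]; rfl
    have h1 := eq_zero_of_isSl2Triple t' (a := lam c) (w := w) (u := μ c • u)
      (by rw [hc, hw]) (by rw [hc, lie_smul, hu, smul_comm])
    exact (smul_eq_zero.mp h1).resolve_right hu0
  exact LinearMap.congr_fun hzero ⟨⟨h, hh⟩, h.2⟩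

end reductive

/-! ### Generalized weight spaces in extensions -/

section weights

open LieModule

variable {H N K : Type*} [LieRing H] [LieAlgebra ℂ H] [LieRing.IsNilpotent H]
  [AddCommGroup N] [Module ℂ N] [LieRingModule H N] [LieModule ℂ H N] [FiniteDimensional ℂ N]
  [AddCommGroup K] [Module ℂ K] [LieRingModule H K] [LieModule ℂ H K] [FiniteDimensional ℂ K]

/-- Split any preimage into its `χ`-component and the rest. The rest maps into the other generalized
weight spaces and, by subtraction, also into that of `χ`; independence makes its image zero. -/
theorem exists_mem_genWeightSpace_of_surjective (φ : N →ₗ⁅ℂ, H⁆ K) (hφ : Function.Surjective φ)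
    (χ : H → ℂ) {v : K} (hv : v ∈ genWeightSpace K χ) : ∃ n ∈ genWeightSpace N χ, φ n = v := by
  have hle : ∀ χ : H → ℂ, ∀ n ∈ genWeightSpace N χ, φ n ∈ genWeightSpace K χ := fun χ n hn =>
    map_genWeightSpace_le φ ((LieSubmodule.mem_map _).mpr ⟨n, hn, rfl⟩)
  obtain ⟨n, rfl⟩ := hφ v
  obtain ⟨a, ha, b, hb, rfl⟩ := (LieSubmodule.mem_sup _ _ _).mp
    (show n ∈ genWeightSpace N χ ⊔ ⨆ (χ' : H → ℂ) (_ : χ' ≠ χ), genWeightSpace N χ' by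
      rw [← iSup_split_single (fun χ' : H → ℂ => genWeightSpace N χ'),
        iSup_genWeightSpace_eq_top ℂ H N]
      trivial)
  refine ⟨a, ha, ?_⟩
  have hb' : φ b ∈ ⨆ (χ' : H → ℂ) (_ : χ' ≠ χ), genWeightSpace K χ' := by
    have : ⨆ (χ' : H → ℂ) (_ : χ' ≠ χ), genWeightSpace N χ' ≤
        (⨆ (χ' : H → ℂ) (_ : χ' ≠ χ), genWeightSpace K χ').comap φ :=
      iSup₂_le fun χ' h n hn => LieSubmodule.mem_comap.mpr
        (le_iSup₂ (f := fun (χ' : H → ℂ) (_ : χ' ≠ χ) => genWeightSpace K χ') χ' h (hle χ' n hn))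
    exact LieSubmodule.mem_comap.mp (this hb)
  have hb'' : φ b ∈ genWeightSpace K χ := by
    rw [map_add] at hv
    simpa using sub_mem hv (hle χ a ha)
  have h0 : φ b ∈ (⊥ : LieSubmodule ℂ H K) :=
    (iSupIndep_genWeightSpace ℂ H K χ).eq_bot ▸ ⟨hb'', hb'⟩
  rw [map_add, (LieSubmodule.mem_bot _).mp h0, add_zero]

/-- In a self-extension of a module whose generalized weight space is a line, the generalized
weight space of the middle term is described by a linear functional. -/
theorem exists_dual_of_exact (φ₁ : K →ₗ⁅ℂ, H⁆ N) (φ₂ : N →ₗ⁅ℂ, H⁆ K)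
    (h₁ : Function.Injective φ₁) (h₂ : Function.Surjective φ₂) (hex : Function.Exact φ₁ φ₂)
    (lam : Module.Dual ℂ H) {v : K} (hv0 : v ≠ 0) (hv : ∀ h : H, ⁅h, v⁆ = lam h • v)
    (hline : ∀ w ∈ genWeightSpace K lam, ∃ c : ℂ, w = c • v) :
    ∃ (μ : Module.Dual ℂ H) (n : N), n ∈ genWeightSpace N lam ∧ φ₂ n = v ∧
      ∀ h : H, ⁅h, n⁆ = lam h • n + μ h • φ₁ v := by
  obtain ⟨n, hn, hnv⟩ := exists_mem_genWeightSpace_of_surjective φ₂ h₂ lam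
    (weightSpace_le_genWeightSpace K lam ((mem_weightSpace (lam : H → ℂ) v).mpr hv))
  -- The difference stays in the generalized weight space and dies under `φ₂`, so it comes from the
  -- line spanned by `v`. As `φ₁ v ≠ 0`, the coefficient is unique and hence linear in `h`.
  have hμ : ∀ h : H, ∃ c : ℂ, ⁅h, n⁆ - lam h • n = c • φ₁ v := by
    intro h
    have hmem : ⁅h, n⁆ - lam h • n ∈ genWeightSpace N lam :=
      sub_mem (LieSubmodule.lie_mem _ hn) ((genWeightSpace N lam).smul_mem _ hn)
    obtain ⟨k, hk⟩ := (hex (⁅h, n⁆ - lam h • n)).mp (by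
      rw [map_sub, LieModuleHom.map_lie, map_smul, hnv, hv, sub_self])
    have hk' : k ∈ genWeightSpace K lam := by
      rw [← comap_genWeightSpace_eq_of_injective h₁, LieSubmodule.mem_comap, hk]
      exact hmem
    obtain ⟨c, rfl⟩ := hline k hk'
    exact ⟨c, by rw [← hk, map_smul]⟩
  choose μ hμ using hμ
  have hu0 : φ₁ v ≠ 0 := fun h => hv0 (h₁ (h.trans (map_zero φ₁).symm))
  have hinj := smul_left_injective ℂ hu0
  refine ⟨⟨⟨μ, fun h h' => hinj ?_⟩, fun c h => hinj ?_⟩, n, hn, hnv, fun h => ?_⟩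
  · simp only
    rw [← hμ, add_smul, ← hμ, ← hμ, map_add, add_lie]
    module
  · simp only [RingHom.id_apply]
    rw [← hμ, smul_assoc, ← hμ, map_smul, smul_lie]
    module
  · exact (sub_eq_iff_eq_add'.mp (hμ h))

end weights

/-! ### From `U(g)`-modules to `g_0`-modules -/

section even

variable {g : Type*} [AddCommGroup g] [Module ℂ g] [LieSuperalgebra g]
variable (N : Type*) [AddCommGroup N] [Module ℂ N] [Module (U g) N] [IsScalarTower ℂ (U g) N]

/-- The action of `g_0` on a `g`-module. -/
abbrev evenLieRingModule : LieRingModule (EvenPart g) N where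
  bracket a n := (ι a.1 : U g) • n
  add_lie a b n := by
    change (ι (a.1 + b.1) : U g) • n = _
    rw [map_add, add_smul]
  lie_add a n n' := smul_add _ _ _
  leibniz_lie a b n := by
    change (ι a.1 : U g) • (ι b.1 : U g) • n =
      (ι (LieSuperalgebra.br a.1 b.1) : U g) • n + (ι b.1 : U g) • (ι a.1 : U g) • n
    rw [← mul_smul, ι_mul 0 0 a.1 b.1 a.2 b.2, sgn_zero_left, one_smul, add_smul, mul_smul,
      add_comm]

theorem evenLieModule :
    letI := evenLieRingModule (g := g) N
    LieModule ℂ (EvenPart g) N :=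
  letI := evenLieRingModule (g := g) N
  { smul_lie := fun c a n => by
      change (ι (c • a.1) : U g) • n = c • (ι a.1 : U g) • n
      rw [map_smul, smul_assoc]
    lie_smul := fun c a n => by
      change (ι a.1 : U g) • c • n = c • (ι a.1 : U g) • n
      rw [← algebraMap_smul_eq (g := g) c n, ← algebraMap_smul_eq (g := g) c, ← mul_smul,
        ← mul_smul, Algebra.commutes] }

variable {N}

theorem map_complex_smul {N' : Type*} [AddCommGroup N'] [Module ℂ N'] [Module (U g) N']
    [IsScalarTower ℂ (U g) N'] (φ : N →ₗ[U g] N') (c : ℂ) (n : N) : φ (c • n) = c • φ n :=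
  (φ.restrictScalars ℂ).map_smul c n

variable (H : LieSubalgebra ℂ (EvenPart g)) (lam : Module.Dual ℂ H)

theorem inGenWeight_iff [LieRing.IsNilpotent H] (n : N) :
    letI := evenLieRingModule (g := g) N
    haveI := evenLieModule (g := g) N
    InGenWeight H lam N n ↔ n ∈ LieModule.genWeightSpace N (lam : H → ℂ) := by
  let := evenLieRingModule (g := g) N
  have := evenLieModule (g := g) N
  rw [LieModule.mem_genWeightSpace]
  have h1 : ∀ (h : H) (s : ℕ), (ι h.1.1 - algebraMap ℂ (U g) (lam h)) ^ s • n =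
      ((LieModule.toEnd ℂ H N h - lam h • (1 : Module.End ℂ N)) ^ s) n := by
    intro h s
    induction s with
    | zero => simp
    | succ s ih =>
      rw [pow_succ', pow_succ', mul_smul, ih, Module.End.mul_apply, sub_smul, algebraMap_smul_eq]
      rfl
  exact forall_congr' fun h => exists_congr fun s => by rw [h1]

theorem SelfExt.finiteDimensional {M : Type*} [AddCommGroup M] [Module ℂ M] [Module (U g) M]
    [IsScalarTower ℂ (U g) M] [SuperModule g M] [FiniteDimensional ℂ M] (E : SelfExt g M) :
    FiniteDimensional ℂ E.N := by
  have hk : LinearMap.ker (E.φ₂.restrictScalars ℂ) = LinearMap.range (E.φ₁.restrictScalars ℂ) := by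
    ext n
    exact E.exact n
  have h1 : Module.Finite ℂ (LinearMap.ker (E.φ₂.restrictScalars ℂ)) := by
    rw [hk]
    infer_instance
  have h2 : Module.Finite ℂ (E.N ⧸ LinearMap.ker (E.φ₂.restrictScalars ℂ)) :=
    Module.Finite.equiv (E.φ₂.restrictScalars ℂ).quotKerEquivRange.symm
  exact Module.Finite.of_submodule_quotient (LinearMap.ker (E.φ₂.restrictScalars ℂ))

/-- A value of `Υ` vanishes on the intersection of the Cartan subalgebra with `[g_0, g_0]`. -/
theorem SelfExt.IsValue.eq_zero [FiniteDimensional ℂ g] [IsReductive (EvenPart g)]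
    [H.IsCartanSubalgebra] {M : Type*} [AddCommGroup M] [Module ℂ M] [Module (U g) M]
    [IsScalarTower ℂ (U g) M] [SuperModule g M] [FiniteDimensional ℂ M] {E : SelfExt g M}
    {v : M} (hv0 : v ≠ 0) (hv : ∀ h : H, (ι h.1.1 : U g) • v = lam h • v)
    {μ : Module.Dual ℂ H} (hμ : E.IsValue H lam v μ) (h : H)
    (hh : (h : EvenPart g) ∈ derivedIdeal (EvenPart g)) : μ h = 0 := by
  let := evenLieRingModule (g := g) E.N
  have := evenLieModule (g := g) E.N
  have := E.finiteDimensional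
  obtain ⟨n, -, -, hn⟩ := hμ
  refine eq_zero_of_mem_derivedIdeal H (lam := lam) (u := E.φ₁ v)
    (fun h0 => hv0 (E.injective (h0.trans (map_zero _).symm))) hn (fun x => ?_) h hh
  change (ι x.1.1 : U g) • E.φ₁ v = _
  rw [← map_smul, hv, map_complex_smul]

/-- A self-extension of a module whose generalized weight space is a line has a value. -/
theorem SelfExt.exists_isValue [H.IsCartanSubalgebra] {M : Type*} [AddCommGroup M] [Module ℂ M]
    [Module (U g) M] [IsScalarTower ℂ (U g) M] [SuperModule g M] [FiniteDimensional ℂ M]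
    (E : SelfExt g M) {v : M} (hv0 : v ≠ 0) (hv : ∀ h : H, (ι h.1.1 : U g) • v = lam h • v)
    (hline : ∀ w : M, InGenWeight H lam M w → ∃ c : ℂ, w = c • v) :
    ∃ μ, E.IsValue H lam v μ := by
  let := evenLieRingModule (g := g) E.N
  have := evenLieModule (g := g) E.N
  let := evenLieRingModule (g := g) M
  have := evenLieModule (g := g) M
  have := E.finiteDimensional
  let φ₁ : M →ₗ⁅ℂ, H⁆ E.N := { E.φ₁.restrictScalars ℂ with map_lie' := fun {x m} => E.φ₁.map_smul _ m }
  let φ₂ : E.N →ₗ⁅ℂ, H⁆ M := { E.φ₂.restrictScalars ℂ with map_lie' := fun {x m} => E.φ₂.map_smul _ m }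
  obtain ⟨μ, n, h1, h2, h3⟩ := exists_dual_of_exact φ₁ φ₂ E.injective E.surjective E.exact lam hv0 hv
    (fun w hw => hline w ((inGenWeight_iff H lam w).mpr hw))
  exact ⟨μ, n, (inGenWeight_iff H lam n).mpr h1, h2, h3⟩

end even

/-! ### Highest weight Kac modules and uniqueness of the value -/

section values

variable {g : Type*} [AddCommGroup g] [Module ℂ g] [LieSuperalgebra g]
  (T : TypeI g)
  {L : Type*} [AddCommGroup L] [Module ℂ L] [LieRingModule (EvenPart g) L]
  [LieModule ℂ (EvenPart g) L] {H B : LieSubalgebra ℂ (EvenPart g)} {lam : Module.Dual ℂ H} {v : L}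

/-- The `λ(z)`-eigenspace of a central `z` is a submodule and contains the generator `v`. -/
theorem IsHighestWeight.lie_center {k : Type*} [LieRing k] [LieAlgebra ℂ k]
    {H B : LieSubalgebra ℂ k} {L : Type*} [AddCommGroup L] [Module ℂ L] [LieRingModule k L]
    [LieModule ℂ k L] {lam : Module.Dual ℂ H} {v : L} (hL : IsHighestWeight H B L lam v) (z : H)
    (hz : (z : k) ∈ LieAlgebra.center ℂ k) (m : L) : ⁅(z : k), m⁆ = lam z • m := by
  let S : LieSubmodule ℂ k L :=
    { toSubmodule := Module.End.eigenspace (LieModule.toEnd ℂ k L z) (lam z)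
      lie_mem := by
        intro x m hm
        have hm' : ⁅(z : k), m⁆ = lam z • m := Module.End.mem_eigenspace_iff.mp hm
        refine Module.End.mem_eigenspace_iff.mpr ?_
        have hzx : ⁅(z : k), x⁆ = 0 := by rw [← lie_skew, hz x, neg_zero]
        change ⁅(z : k), ⁅x, m⁆⁆ = lam z • ⁅x, m⁆
        rw [leibniz_lie, hzx, zero_lie, zero_add, hm', lie_smul] }
  have hS : S = ⊤ := by
    rw [eq_top_iff, ← hL.generates, LieSubmodule.lieSpan_le, Set.singleton_subset_iff]
    exact Module.End.mem_eigenspace_iff.mpr (hL.weight z)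
  exact Module.End.mem_eigenspace_iff.mp (show m ∈ S by rw [hS]; trivial)

/-- The Kac module of a highest weight module is a highest weight module. -/
theorem isSuperHighestWeight_kac (hL : IsHighestWeight H B L lam v) :
    IsSuperHighestWeight T H B (Kac T L) lam (Kac.mk T L v) where
  ne_zero h := hL.ne_zero (Kac.mk_injective (T := T) (h.trans (map_zero _).symm))
  weight h := by rw [Kac.ι_even_smul_mk, hL.weight, map_smul]
  killed_even x hx y hy := by rw [Kac.ι_even_smul_mk, hL.killed x hx y hy, map_zero]
  killed_pos b hb := Kac.ι_pos_smul_mk T L b hb v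
  generates := by
    let S : LieSubmodule ℂ (EvenPart g) L :=
      { toSubmodule := ((Submodule.span (U g) {Kac.mk T L v}).restrictScalars ℂ).comap (Kac.mk T L)
        lie_mem := by
          intro x m hm
          change Kac.mk T L ⁅x, m⁆ ∈ Submodule.span (U g) {Kac.mk T L v}
          rw [← Kac.ι_even_smul_mk]
          exact Submodule.smul_mem _ _ hm }
    have hS : S = ⊤ := by
      rw [eq_top_iff, ← hL.generates, LieSubmodule.lieSpan_le, Set.singleton_subset_iff]
      exact Submodule.mem_span_singleton_self (Kac.mk T L v)
    rw [eq_top_iff]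
    intro k _
    induction k using Kac.induction_mk with
    | smul u m => exact Submodule.smul_mem _ _ (show m ∈ S by rw [hS]; trivial)
    | add s t hs ht => exact add_mem (hs trivial) (ht trivial)

variable [FiniteDimensional ℂ g] [IsReductive (EvenPart g)] [H.IsCartanSubalgebra]
  [FiniteDimensional ℂ L]

/-- No condition on the weight space of `K(L)` is required: values vanish on `H ∩ [g_0, g_0]`, and
on the centre they are compared after projecting to `L`. -/
theorem SelfExt.IsValue.unique (hL : IsHighestWeight H B L lam v) {E : SelfExt g (Kac T L)}
    {μ μ' : Module.Dual ℂ H} (h : E.IsValue H lam (Kac.mk T L v) μ)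
    (h' : E.IsValue H lam (Kac.mk T L v) μ') : μ = μ' := by
  have hK := isSuperHighestWeight_kac T hL
  have := Kac.finiteDimensional (T := T) (M := L)
  have hc : ∀ (z : LieAlgebra.center ℂ (EvenPart g)) (hz : (z : EvenPart g) ∈ H),
      μ ⟨z, hz⟩ = μ' ⟨z, hz⟩ := by
    intro z hz
    obtain ⟨n, -, hn, hn'⟩ := h
    obtain ⟨n', -, hm, hm'⟩ := h'
    obtain ⟨k, hk⟩ := (E.exact (n - n')).mp (by rw [map_sub, hn, hm, sub_self])
    have h1 : (ι z.1.1 : U g) • k =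
        lam ⟨z, hz⟩ • k + (μ ⟨z, hz⟩ - μ' ⟨z, hz⟩) • Kac.mk T L v := by
      refine E.injective ?_
      rw [map_smul, map_add, map_complex_smul, map_complex_smul, hk, smul_sub]
      refine (congrArg₂ (· - ·) (hn' ⟨z, hz⟩) (hm' ⟨z, hz⟩)).trans ?_
      module
    -- Two lifts differ by some `k` in `K(L)`. In `L` the element `z` acts by `λ(z)`, so the
    -- projection of `k` drops out and `(μ - μ')(z) v = 0` remains.
    have h2 := congrArg (Kac.proj T L) h1
    rw [Kac.proj_even_smul, map_add, map_smul, map_smul, Kac.proj_mk,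
      hL.lie_center ⟨z, hz⟩ z.2, left_eq_add] at h2
    exact sub_eq_zero.mp ((smul_eq_zero.mp h2).resolve_right hL.ne_zero)
  refine LinearMap.ext fun x => ?_
  obtain ⟨z, d, hzd⟩ := exists_center_add_derived H x
  have hzH := center_le_of_isCartanSubalgebra H z.2
  have hx : x = (⟨z, hzH⟩ : H) + derivedCartanHom H d := Subtype.ext hzd
  rw [hx, map_add, map_add, hc,
    h.eq_zero H lam hK.ne_zero hK.weight (derivedCartanHom H d) d.1.2,
    h'.eq_zero H lam hK.ne_zero hK.weight (derivedCartanHom H d) d.1.2]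

theorem Upsilon_mk (hL : IsHighestWeight H B L lam v) {E : SelfExt g (Kac T L)}
    {μ : Module.Dual ℂ H} (h : E.IsValue H lam (Kac.mk T L v) μ) :
    Upsilon H lam (Kac.mk T L v) ⟦E⟧ = μ := by
  have hex : ∃ μ, E.IsValue H lam (Kac.mk T L v) μ := ⟨μ, h⟩
  refine (dif_pos hex).trans ?_
  exact SelfExt.IsValue.unique T hL hex.choose_spec h

end values

/-! ### The extensions `K(L;2;ν)` and the image of `Υ` -/

section jordan

open Jordan

variable {g : Type*} [AddCommGroup g] [Module ℂ g] [LieSuperalgebra g]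
  [IsReductive (EvenPart g)] (T : TypeI g)
  (L : Type*) [AddCommGroup L] [Module ℂ L] [LieRingModule (EvenPart g) L]
  [LieModule ℂ (EvenPart g) L]
  (ν : Module.Dual ℂ (LieAlgebra.center ℂ (EvenPart g)))

/-- The self-extension of `K(L)` with middle term `K(L ⊗ J_2(ν))`. -/
def kacExt : SelfExt g (Kac T L) where
  N := Kac T (L ⊗[ℂ] Jordan 2 ν)
  φ₁ := Kac.map T (tensorLast ν L (n := 2) two_pos)
  φ₂ := Kac.map T (tensorCoord ν L (n := 2) two_pos)
  even₁ := Kac.isEvenMap_map _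
  even₂ := Kac.isEvenMap_map _
  injective := Kac.map_injective _ (tensorLast_injective ν L two_pos)
  surjective := Kac.map_surjective _ (tensorCoord_surjective ν L two_pos)
  exact := Kac.exact_map _ _ (exact_tensorLast_tensorCoord L ν)

theorem Jordan.shift_first : Jordan.shift 2 ν (first ν two_pos) = last ν two_pos := by
  refine funext fun i => ?_
  fin_cases i
  · rfl
  · rfl

variable {L} {H B : LieSubalgebra ℂ (EvenPart g)} {lam : Module.Dual ℂ H} {v : L}

/-- The lift is `1 ⊗ (v ⊗ v_1)`: the shift takes `v_1` to `v_2`, and `v ⊗ v_2` is the image of `v`.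
Both lie in the generalized weight space, with exponent `2` sufficing. -/
theorem isValue_kacExt (hv : ∀ h : H, ⁅(h : EvenPart g), v⁆ = lam h • v) :
    (kacExt T L ν).IsValue H lam (Kac.mk T L v) ((extendCenter ν).comp H.toSubmodule.subtype) := by
  set w := Kac.mk T (L ⊗[ℂ] Jordan 2 ν) (v ⊗ₜ first ν two_pos) with hw
  set u := Kac.mk T (L ⊗[ℂ] Jordan 2 ν) (v ⊗ₜ last ν two_pos) with hu
  have h1 : ∀ h : H, (ι h.1.1 : U g) • w = lam h • w + extendCenter ν h.1 • u := by
    intro h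
    rw [hw, Kac.ι_even_smul_mk, TensorProduct.LieModule.lie_tmul_right, hv, Jordan.lie_def,
      shift_first, TensorProduct.tmul_smul, map_add, map_smul, ← TensorProduct.smul_tmul', map_smul]
  have h2 : ∀ h : H, (ι h.1.1 : U g) • u = lam h • u := by
    intro h
    rw [hu, Kac.ι_even_smul_mk, TensorProduct.LieModule.lie_tmul_right, hv, Jordan.lie_def,
      shift_last, smul_zero, TensorProduct.tmul_zero, add_zero, ← TensorProduct.smul_tmul',
      map_smul]
  have h3 : (kacExt T L ν).φ₁ (Kac.mk T L v) = u := Kac.map_mk _ v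
  refine ⟨w, fun h => ⟨2, ?_⟩, ?_, fun h => ?_⟩
  · have h4 : (ι h.1.1 - algebraMap ℂ (U g) (lam h)) • w = extendCenter ν h.1 • u := by
      rw [sub_smul, algebraMap_smul_eq, h1, add_sub_cancel_left]
    have h5 : (ι h.1.1 - algebraMap ℂ (U g) (lam h)) • u = 0 := by
      rw [sub_smul, algebraMap_smul_eq, h2, sub_self]
    have h6 : (ι h.1.1 - algebraMap ℂ (U g) (lam h)) ^ 2 • w = 0 := by
      rw [pow_two, mul_smul, h4, ← algebraMap_smul_eq (g := g) (extendCenter ν h.1), ← mul_smul,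
        ← Algebra.commutes, mul_smul, h5, smul_zero]
    exact h6
  · refine (Kac.map_mk _ _).trans ?_
    rw [tensorCoord_tmul, coord_first, one_smul]
  · rw [h3]
    exact h1 h

theorem extendCenter_of_mem_derivedIdeal {x : EvenPart g} (hx : x ∈ derivedIdeal (EvenPart g)) :
    extendCenter ν x = 0 := by
  rw [extendCenter, LinearMap.comp_apply, Submodule.projectionOnto_apply_of_mem_right _ hx]
  exact map_zero ν

theorem exists_extendCenter_eq [H.IsCartanSubalgebra] (μ : Module.Dual ℂ H)
    (hμ : ∀ h : H, (h : EvenPart g) ∈ derivedIdeal (EvenPart g) → μ h = 0) :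
    ∃ ν : Module.Dual ℂ (LieAlgebra.center ℂ (EvenPart g)),
      (extendCenter ν).comp H.toSubmodule.subtype = μ := by
  have hZ : (LieAlgebra.center ℂ (EvenPart g)).toSubmodule ≤ H.toSubmodule := fun z hz =>
    center_le_of_isCartanSubalgebra H hz
  -- `ν` is the restriction of `μ` to the centre, which lies in `H`; both sides agree there and
  -- vanish on `H ∩ [g_0, g_0]`.
  refine ⟨μ ∘ₗ Submodule.inclusion hZ, LinearMap.ext fun x => ?_⟩
  obtain ⟨z, d, hzd⟩ := exists_center_add_derived H x
  have hx : x = (⟨z, hZ z.2⟩ : H) + derivedCartanHom H d := Subtype.ext hzd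
  change extendCenter (μ ∘ₗ Submodule.inclusion hZ) (x : EvenPart g) = μ x
  rw [hzd, map_add, extendCenter_center, extendCenter_of_mem_derivedIdeal _ d.1.2, hx, map_add,
    hμ (derivedCartanHom H d) d.1.2]
  rfl

theorem range_Upsilon [FiniteDimensional ℂ g] [H.IsCartanSubalgebra] [FiniteDimensional ℂ L]
    (hL : IsHighestWeight H B L lam v) :
    Set.range (Upsilon (g := g) (M := Kac T L) H lam (Kac.mk T L v)) =
      {μ : Module.Dual ℂ H | ∀ h : H,
        (h : EvenPart g) ∈ derivedIdeal (EvenPart g) → μ h = 0} := by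
  have hK := isSuperHighestWeight_kac T hL
  have := Kac.finiteDimensional (T := T) (M := L)
  refine Set.Subset.antisymm ?_ fun μ hμ => ?_
  · rintro _ ⟨q, rfl⟩
    induction q using Quotient.inductionOn with
    | h E =>
      by_cases hex : ∃ μ, E.IsValue H lam (Kac.mk T L v) μ
      · obtain ⟨μ, hμ⟩ := hex
        rw [Upsilon_mk T hL hμ]
        exact hμ.eq_zero H lam hK.ne_zero hK.weight
      -- A class without a value is sent to the default `0`, which satisfies the vanishing
      -- condition, so the image is not enlarged.
      · have h0 : Upsilon H lam (Kac.mk T L v) ⟦E⟧ = 0 := dif_neg hex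
        rw [h0]
        exact fun _ _ => rfl
  · obtain ⟨ν, rfl⟩ := exists_extendCenter_eq μ hμ
    exact ⟨⟦kacExt T L ν⟧, Upsilon_mk T hL (isValue_kacExt T ν hL.weight)⟩

end jordan

end SuperLie

end

theorem mainTheorem2
    {g : Type*} [AddCommGroup g] [Module ℂ g] [LieSuperalgebra g] [IsQuasiReductive g]
    (T : TypeI g)
    {L : Type*} [AddCommGroup L] [Module ℂ L] [LieRingModule (EvenPart g) L]
    [LieModule ℂ (EvenPart g) L] :
    -- the filtration of `K(L ⊗ J_n(ν))`
    (∀ (n : ℕ) (ν : Module.Dual ℂ (LieAlgebra.center ℂ (EvenPart g))),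
      HasFiltration g n (Kac T (L ⊗[ℂ] Jordan n ν)) (Kac T L)) ∧
    -- indecomposability of `K(L ⊗ J_n(ν))`
    (∀ (n : ℕ) (ν : Module.Dual ℂ (LieAlgebra.center ℂ (EvenPart g))), 1 ≤ n →
      IsLieIndecomposable (EvenPart g) L →
      (n = 1 ∨ ∃ z : LieAlgebra.center ℂ (EvenPart g), ν z ≠ 0 ∧
        ∃ c : ℂ, ∀ m : L, ⁅(z : EvenPart g), m⁆ = c • m) →
      IsIndecomposable (U g) (Kac T (L ⊗[ℂ] Jordan n ν))) ∧
    -- the image of `Υ_{K(L)}` for a finite-dimensional highest weight module `L`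
    (∀ (H B : LieSubalgebra ℂ (EvenPart g)), H.IsCartanSubalgebra → IsBorel H B →
      ∀ (lam : Module.Dual ℂ H) (v : L), FiniteDimensional ℂ L → IsHighestWeight H B L lam v →
      FiniteDimensional ℂ (Kac T L) ∧
      IsSuperHighestWeight T H B (Kac T L) lam (Kac.mk T L v) ∧
      ((∀ w : Kac T L, InGenWeight H lam (Kac T L) w → ∃ c : ℂ, w = c • Kac.mk T L v) →
        ∀ E : SelfExt g (Kac T L), ∃! μ, E.IsValue H lam (Kac.mk T L v) μ) ∧
      (∀ ν : Module.Dual ℂ (LieAlgebra.center ℂ (EvenPart g)),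
        ∃ (E : SelfExt g (Kac T L)) (e : E.N ≃ₗ[U g] Kac T (L ⊗[ℂ] Jordan 2 ν)),
          IsEvenMap e.toLinearMap ∧
          E.IsValue H lam (Kac.mk T L v) ((extendCenter ν).comp H.toSubmodule.subtype) ∧
          Upsilon H lam (Kac.mk T L v) ⟦E⟧ = (extendCenter ν).comp H.toSubmodule.subtype) ∧
      Set.range (Upsilon (g := g) (M := Kac T L) H lam (Kac.mk T L v)) =
        {μ : Module.Dual ℂ H | ∀ h : H,
          (h : EvenPart g) ∈ ⁅(⊤ : LieIdeal ℂ (EvenPart g)), (⊤ : LieIdeal ℂ (EvenPart g))⁆ → μ h = 0}) := by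
  have : FiniteDimensional ℂ g := IsQuasiReductive.finite
  refine ⟨hasFiltration_kac T L, fun n ν hn hL h =>
    isIndecomposable_kac T (isLieIndecomposable_tensor ν hn hL h), ?_⟩
  intro H B hH _ lam v _ hL
  have hfin := Kac.finiteDimensional (T := T) (M := L)
  have hK := isSuperHighestWeight_kac T hL
  refine ⟨hfin, hK, fun hline E => ?_, fun ν => ?_, range_Upsilon T hL⟩
  · obtain ⟨μ, hμ⟩ := E.exists_isValue H lam hK.ne_zero hK.weight hline
    exact ⟨μ, hμ, fun μ' hμ' => SelfExt.IsValue.unique T hL hμ' hμ⟩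
  · have hν := isValue_kacExt T ν hL.weight
    exact ⟨kacExt T L ν, LinearEquiv.refl _ _, fun _ => rfl, hν, Upsilon_mk T hL hν⟩
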